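/- Let $\Gamma\rightrightarrows M$ be a Lie groupoid with source $s$, target $t$, unit map $u$, inversion $\iota$ and multiplication $m:\Gamma^{(2)}\to\Gamma$, where $\Gamma^{(2)}=\{(g,h)\in\Gamma\times\Gamma: t(g)=s(h)\}$. For $k\ge 1$, a skew-symmetric $(k,1)$-tensor on a manifold is a smooth bundle map $\wedge^kT\to T$ over the identity. A pair $(\varphi_\Gamma,\varphi_M)$ of such tensors on $\Gamma$ and $M$ is called a multiplicative $(k,1)$-tensor if it is a morphism from $\wedge^kT\Gamma\rightrightarrows\wedge^kTM$, with structure maps $\wedge^kTs$, $\wedge^kTt$, $\wedge^kTu$, $\wedge^kT\iota$ and $\wedge^kTm:\wedge^kT\Gamma^{(2)}\to\wedge^kT\Gamma$, to the tangent groupoid $T\Gamma\rightrightarrows TM$; that is, $$Ts\circ\varphi_\Gamma=\varphi_M\circ\wedge^kTs,\qquad Tt\circ\varphi_\Gamma=\varphi_M\circ\wedge^kTt,\qquad \varphi_\Gamma\circ\wedge^kTu=Tu\circ\varphi_M,\qquad \varphi_\Gamma\circ\wedge^kT\iota=T\iota\circ\varphi_\Gamma,$$ and, for every $(g,h)\in\Gamma^{(2)}$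 and every $\Xi\in\wedge^kT_{(g,h)}\Gamma^{(2)}$, the vectors $\varphi_\Gamma(\wedge^kT\mathrm{pr}_1\,\Xi)$ and $\varphi_\Gamma(\wedge^kT\mathrm{pr}_2\,\Xi)$ are composable in $T\Gamma\rightrightarrows TM$ and $$\varphi_\Gamma\big(\wedge^kTm\,(\Xi)\big)=Tm\big(\varphi_\Gamma(\wedge^kT\mathrm{pr}_1\,\Xi),\ \varphi_\Gamma(\wedge^kT\mathrm{pr}_2\,\Xi)\big).$$ The Nijenhuis torsion of a $(1,1)$-tensor $\varphi$ is the $(2,1)$-tensor $\mathcal N_\varphi$ determined by $$\mathcal N_\varphi(V\wedge W)=[\varphi V,\varphi W]-\varphi\big([\varphi V,W]+[V,\varphi W]-\varphi[V,W]\big)$$ for all local vector fields $V,W$. If $(\varphi_\Gamma,\varphi_M)$ is a multiplicative $(1,1)$-tensor on $\Gamma\rightrightarrows M$, then $(\mathcal N_{\varphi_\Gamma},\mathcal N_{\varphi_M})$ is a multiplicative $(2,1)$-tensor on $\Gamma\rightrightarrows M$. -/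

import Mathlib

open scoped Manifold ContDiff Topology

noncomputable section

/-! ### Skew-symmetric `(k,1)`-tensors -/

/-- A smooth skew-symmetric `(k,1)`-tensor on a smooth manifold `M` (modelled on `E`): a smooth
bundle map `∧ᵏ TM → TM` over the identity.  Smoothness is tested on smooth local vector fields. -/
structure AltTensor (E : Type*) [NormedAddCommGroup E] [NormedSpace ℝ E]
    (M : Type*) [TopologicalSpace M] [ChartedSpace E M] [IsManifold 𝓘(ℝ, E) ∞ M] (k : ℕ) where
  /-- the linear map `∧ᵏ TₓM → TₓM` -/
  toFun : ∀ x : M, ⋀[ℝ]^k (TangentSpace 𝓘(ℝ, E) x) →ₗ[ℝ] TangentSpace 𝓘(ℝ, E) x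
  smooth : ∀ (U : Set M), IsOpen U → ∀ V : Fin k → ∀ x : M, TangentSpace 𝓘(ℝ, E) x,
    (∀ i, ContMDiffOn 𝓘(ℝ, E) (𝓘(ℝ, E)).tangent ∞
      (fun x => (⟨x, V i x⟩ : TangentBundle 𝓘(ℝ, E) M)) U) →
    ContMDiffOn 𝓘(ℝ, E) (𝓘(ℝ, E)).tangent ∞
      (fun x => (⟨x, toFun x (exteriorPower.ιMulti ℝ k fun i => V i x)⟩ :
        TangentBundle 𝓘(ℝ, E) M)) U

namespace AltTensor

variable {E : Type*} [NormedAddCommGroup E] [NormedSpace ℝ E]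
  {M : Type*} [TopologicalSpace M] [ChartedSpace E M] [IsManifold 𝓘(ℝ, E) ∞ M]

/-- A `(1,1)`-tensor as a field of endomorphisms `TₓM → TₓM`, via `∧¹ TₓM = TₓM`. -/
def endo (φ : AltTensor E M 1) (x : M) : TangentSpace 𝓘(ℝ, E) x →ₗ[ℝ] TangentSpace 𝓘(ℝ, E) x :=
  φ.toFun x ∘ₗ (exteriorPower.oneEquiv ℝ (TangentSpace 𝓘(ℝ, E) x)).symm.toLinearMap

/-- `φ V` for a `(1,1)`-tensor `φ` and a vector field `V`. -/
def onField (φ : AltTensor E M 1) (V : ∀ x : M, TangentSpace 𝓘(ℝ, E) x) :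
    ∀ x : M, TangentSpace 𝓘(ℝ, E) x :=
  fun x => φ.endo x (V x)

/-- `[φV, φW] - φ([φV, W] + [V, φW] - φ[V, W])` for vector fields `V`, `W`. -/
def torsionField (φ : AltTensor E M 1) (V W : ∀ x : M, TangentSpace 𝓘(ℝ, E) x) :
    ∀ x : M, TangentSpace 𝓘(ℝ, E) x :=
  VectorField.mlieBracket 𝓘(ℝ, E) (φ.onField V) (φ.onField W)
    - φ.onField (VectorField.mlieBracket 𝓘(ℝ, E) (φ.onField V) W
        + VectorField.mlieBracket 𝓘(ℝ, E) V (φ.onField W)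
        - φ.onField (VectorField.mlieBracket 𝓘(ℝ, E) V W))

lemma endo_apply (φ : AltTensor E M 1) (x : M) (v : TangentSpace 𝓘(ℝ, E) x) :
    φ.endo x v = φ.toFun x (exteriorPower.ιMulti ℝ 1 fun _ => v) := by
  have h2 : (exteriorPower.oneEquiv ℝ (TangentSpace 𝓘(ℝ, E) x)).symm v
      = exteriorPower.ιMulti ℝ 1 fun _ : Fin 1 => v := by
    rw [LinearEquiv.symm_apply_eq, exteriorPower.oneEquiv_ιMulti]
  simp only [endo, LinearMap.comp_apply, LinearEquiv.coe_coe, h2]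

lemma onField_smoothOn (φ : AltTensor E M 1) {U : Set M} (hU : IsOpen U)
    {V : ∀ x : M, TangentSpace 𝓘(ℝ, E) x} (hV : CMDiff[U] ∞ (T% V)) :
    CMDiff[U] ∞ (T% (φ.onField V)) := by
  have := φ.smooth U hU (fun _ => V) (fun _ => hV)
  simpa only [onField, endo_apply] using this

lemma onField_add (φ : AltTensor E M 1) (V W : ∀ x : M, TangentSpace 𝓘(ℝ, E) x) :
    φ.onField (V + W) = φ.onField V + φ.onField W := by
  ext x; simp [onField]

lemma onField_smul (φ : AltTensor E M 1) (f : M → ℝ) (V : ∀ x : M, TangentSpace 𝓘(ℝ, E) x) :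
    φ.onField (f • V) = f • φ.onField V := by
  ext x; simp [onField]

lemma torsionField_apply (φ : AltTensor E M 1) (V W : ∀ x : M, TangentSpace 𝓘(ℝ, E) x) (x : M) :
    φ.torsionField V W x =
      VectorField.mlieBracket 𝓘(ℝ, E) (φ.onField V) (φ.onField W) x
        - φ.endo x (VectorField.mlieBracket 𝓘(ℝ, E) (φ.onField V) W x
          + VectorField.mlieBracket 𝓘(ℝ, E) V (φ.onField W) x
          - φ.endo x (VectorField.mlieBracket 𝓘(ℝ, E) V W x)) := rfl

lemma torsionField_swap (φ : AltTensor E M 1) (V W : ∀ x : M, TangentSpace 𝓘(ℝ, E) x) (x : M) :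
    φ.torsionField V W x = - φ.torsionField W V x := by
  rw [torsionField_apply, torsionField_apply,
    VectorField.mlieBracket_swap_apply (V := φ.onField V) (W := φ.onField W),
    VectorField.mlieBracket_swap_apply (V := φ.onField V) (W := W),
    VectorField.mlieBracket_swap_apply (V := V) (W := φ.onField W),
    VectorField.mlieBracket_swap_apply (V := V) (W := W)]
  simp only [map_add, map_sub, map_neg]
  abel

variable [FiniteDimensional ℝ E]

lemma onField_expand (φ : AltTensor E M 1) (x : M) (V : ∀ x : M, TangentSpace 𝓘(ℝ, E) x) :
    let t := trivializationAt E (TangentSpace 𝓘(ℝ, E) : M → Type _) x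
    let b := Module.Basis.ofVectorSpace ℝ E
    ∀ᶠ y in 𝓝 x, φ.onField V y
      = ∑ i, t.localFrameCoeff 𝓘(ℝ, E) b i y (V y) • φ.onField (t.localFrame b i) y := by
  intro t b
  have x_mem : x ∈ t.baseSet := FiberBundle.mem_baseSet_trivializationAt E _ x
  filter_upwards [t.eventually_eq_localFrame_sum_coeff_smul (I := 𝓘(ℝ, E)) (s := V) b x_mem]
    with y hy
  conv_lhs => rw [onField, hy]
  simp [onField]

lemma onField_mdiffAt (φ : AltTensor E M 1) {x : M}
    {V : ∀ x : M, TangentSpace 𝓘(ℝ, E) x} (hV : MDiffAt (T% V) x) :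
    MDiffAt (T% (φ.onField V)) x := by
  have : IsManifold 𝓘(ℝ, E) 2 M := IsManifold.of_le (n := ∞) (by norm_cast)
  have : IsManifold 𝓘(ℝ, E) 1 M := IsManifold.of_le (n := ∞) (by norm_cast)
  have : IsManifold 𝓘(ℝ, E) (∞ + 1) M := inferInstanceAs (IsManifold 𝓘(ℝ, E) ∞ M)
  let t := trivializationAt E (TangentSpace 𝓘(ℝ, E) : M → Type _) x
  let b := Module.Basis.ofVectorSpace ℝ E
  have x_mem : x ∈ t.baseSet := FiberBundle.mem_baseSet_trivializationAt E _ x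
  have h1 : MDiffAt (T% (fun y => ∑ i, t.localFrameCoeff 𝓘(ℝ, E) b i y (V y) •
      φ.onField (t.localFrame b i) y)) x := by
    refine MDifferentiableAt.sum_section fun i _ => ?_
    refine MDifferentiableAt.smul_section (mdifferentiableAt_localFrameCoeff b x_mem hV i) ?_
    have := φ.onField_smoothOn t.open_baseSet (t.contMDiffOn_localFrame_baseSet ∞ b i)
    exact (this.contMDiffAt (t.open_baseSet.mem_nhds x_mem)).mdifferentiableAt (by simp)
  refine h1.congr_of_eventuallyEq ?_
  filter_upwards [φ.onField_expand x V] with y hy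
  simp only [hy, t, b]

lemma torsionField_tensorial_left (φ : AltTensor E M 1) (x : M)
    (W : ∀ x : M, TangentSpace 𝓘(ℝ, E) x) :
    TensorialAt 𝓘(ℝ, E) E (fun V => φ.torsionField V W x) x where
  smul {f V} hf hV := by
    have : IsManifold 𝓘(ℝ, E) 2 M := IsManifold.of_le (n := ∞) (by norm_cast)
    have hφV := φ.onField_mdiffAt hV
    simp only [torsionField_apply, onField_smul,
      VectorField.mlieBracket_smul_left hf hV, VectorField.mlieBracket_smul_left hf hφV,
      map_add, map_sub, map_smul, smul_add, smul_sub]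
    simp only [onField]
    module
  add {V V'} hV hV' := by
    have : IsManifold 𝓘(ℝ, E) 2 M := IsManifold.of_le (n := ∞) (by norm_cast)
    have hφV := φ.onField_mdiffAt hV
    have hφV' := φ.onField_mdiffAt hV'
    simp only [torsionField_apply, onField_add,
      VectorField.mlieBracket_add_left hV hV', VectorField.mlieBracket_add_left hφV hφV',
      map_add, map_sub]
    abel

lemma torsionField_tensorial_right (φ : AltTensor E M 1) (x : M)
    (V : ∀ x : M, TangentSpace 𝓘(ℝ, E) x) :
    TensorialAt 𝓘(ℝ, E) E (fun W => φ.torsionField V W x) x where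
  smul {f W} hf hW := by
    have := (φ.torsionField_tensorial_left x V).smul hf hW
    rw [φ.torsionField_swap V, φ.torsionField_swap V, this, smul_neg]
  add {W W'} hW hW' := by
    have := (φ.torsionField_tensorial_left x V).add hW hW'
    rw [φ.torsionField_swap V, φ.torsionField_swap V, φ.torsionField_swap V, this, neg_add]

/-- The Nijenhuis torsion at a point, as a bilinear map on the tangent space. -/
def torsionBilin (φ : AltTensor E M 1) (x : M) :
    TangentSpace 𝓘(ℝ, E) x →L[ℝ] TangentSpace 𝓘(ℝ, E) x →L[ℝ] TangentSpace 𝓘(ℝ, E) x :=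
  have : IsManifold 𝓘(ℝ, E) (1 + 1) M := IsManifold.of_le (n := ∞) (by norm_cast)
  have : IsManifold 𝓘(ℝ, E) 1 M := IsManifold.of_le (n := ∞) (by norm_cast)
  TensorialAt.mkHom₂ (I := 𝓘(ℝ, E)) (F := E) (F' := E) (fun V W => φ.torsionField V W x) x
    (fun W _ => φ.torsionField_tensorial_left x W)
    (fun V _ => φ.torsionField_tensorial_right x V)

lemma torsionBilin_apply (φ : AltTensor E M 1) {x : M} {V W : ∀ x : M, TangentSpace 𝓘(ℝ, E) x}
    (hV : MDiffAt (T% V) x) (hW : MDiffAt (T% W) x) :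
    φ.torsionBilin x (V x) (W x) = φ.torsionField V W x := by
  have : IsManifold 𝓘(ℝ, E) (1 + 1) M := IsManifold.of_le (n := ∞) (by norm_cast)
  have : IsManifold 𝓘(ℝ, E) 1 M := IsManifold.of_le (n := ∞) (by norm_cast)
  exact TensorialAt.mkHom₂_apply _ _ hV hW

lemma torsionBilin_self (φ : AltTensor E M 1) (x : M) (v : TangentSpace 𝓘(ℝ, E) x) :
    φ.torsionBilin x v v = 0 := by
  have : IsManifold 𝓘(ℝ, E) (1 + 1) M := IsManifold.of_le (n := ∞) (by norm_cast)
  have : IsManifold 𝓘(ℝ, E) 1 M := IsManifold.of_le (n := ∞) (by norm_cast)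
  have h := TensorialAt.mkHom₂_apply_eq_extend (I := 𝓘(ℝ, E)) (F := E) (F' := E)
    (fun W _ => φ.torsionField_tensorial_left x W)
    (fun V _ => φ.torsionField_tensorial_right x V) v v
  have h2 := φ.torsionField_swap (FiberBundle.extend E v) (FiberBundle.extend E v) x
  refine h.trans ?_
  have h3 := eq_neg_iff_add_eq_zero.mp h2
  rw [← two_smul ℝ] at h3
  exact (smul_eq_zero_iff_right (two_ne_zero' ℝ)).mp h3

/-- The Nijenhuis torsion at a point, as an alternating map on the tangent space. -/
def torsionAlt (φ : AltTensor E M 1) (x : M) :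
    TangentSpace 𝓘(ℝ, E) x [⋀^Fin 2]→ₗ[ℝ] TangentSpace 𝓘(ℝ, E) x where
  toFun v := φ.torsionBilin x (v 0) (v 1)
  map_update_add' v i a b := by
    fin_cases i <;> simp [Function.update]
  map_update_smul' v i c a := by
    fin_cases i <;> simp [Function.update]
  map_eq_zero_of_eq' v i j h hij := by
    have h01 : v 0 = v 1 := by
      fin_cases i <;> fin_cases j <;> simp_all
    rw [h01, torsionBilin_self]

lemma torsionField_smoothOn (φ : AltTensor E M 1) {U : Set M} (hU : IsOpen U)
    {V W : ∀ x : M, TangentSpace 𝓘(ℝ, E) x} (hV : CMDiff[U] ∞ (T% V)) (hW : CMDiff[U] ∞ (T% W)) :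
    CMDiff[U] ∞ (T% (φ.torsionField V W)) := by
  have br : ∀ {V W : ∀ x : M, TangentSpace 𝓘(ℝ, E) x}, CMDiff[U] ∞ (T% V) →
      CMDiff[U] ∞ (T% W) → CMDiff[U] ∞ (T% (VectorField.mlieBracket 𝓘(ℝ, E) V W)) := by
    intro V W hV hW x hx
    have : IsManifold 𝓘(ℝ, E) (((⊤ : ℕ∞) : WithTop ℕ∞) + 1) M :=
      inferInstanceAs (IsManifold 𝓘(ℝ, E) ∞ M)
    have : IsManifold 𝓘(ℝ, E) (minSmoothness ℝ 2) M := by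
      simpa using (IsManifold.of_le (n := ∞) (by norm_cast) : IsManifold 𝓘(ℝ, E) 2 M)
    exact (ContMDiffAt.mlieBracket_vectorField (m := ⊤) (n := ⊤) (hV.contMDiffAt (hU.mem_nhds hx))
      (hW.contMDiffAt (hU.mem_nhds hx)) (by simp)).contMDiffWithinAt
  have hφV := φ.onField_smoothOn hU hV
  have hφW := φ.onField_smoothOn hU hW
  have h1 := (br hφV hW).add_section (br hV hφW)
  have h2 := h1.sub_section (φ.onField_smoothOn hU (br hV hW))
  exact (br hφV hφW).sub_section (φ.onField_smoothOn hU h2)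

/-- The Nijenhuis torsion `N_φ` of a `(1,1)`-tensor `φ`: the `(2,1)`-tensor with
`N_φ(V ∧ W) = [φV, φW] - φ([φV, W] + [V, φW] - φ[V, W])` for all local vector fields `V`, `W`. -/
def nijenhuis (φ : AltTensor E M 1) : AltTensor E M 2 where
  toFun x := exteriorPower.alternatingMapLinearEquiv (φ.torsionAlt x)
  smooth U hU V hV := by
    refine (φ.torsionField_smoothOn hU (hV 0) (hV 1)).congr fun x hx => ?_
    rw [exteriorPower.alternatingMapLinearEquiv_apply_ιMulti]
    have h0 := ((hV 0).contMDiffAt (hU.mem_nhds hx)).mdifferentiableAt (by simp)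
    have h1 := ((hV 1).contMDiffAt (hU.mem_nhds hx)).mdifferentiableAt (by simp)
    exact congrArg (Bundle.TotalSpace.mk x) (φ.torsionBilin_apply h0 h1)

lemma nijenhuis_apply (φ : AltTensor E M 1) {x : M} {V W : ∀ x : M, TangentSpace 𝓘(ℝ, E) x}
    (hV : MDiffAt (T% V) x) (hW : MDiffAt (T% W) x) :
    φ.nijenhuis.toFun x (exteriorPower.ιMulti ℝ 2 ![V x, W x]) =
      VectorField.mlieBracket 𝓘(ℝ, E) (φ.onField V) (φ.onField W) x
        - φ.endo x (VectorField.mlieBracket 𝓘(ℝ, E) (φ.onField V) W x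
          + VectorField.mlieBracket 𝓘(ℝ, E) V (φ.onField W) x
          - φ.endo x (VectorField.mlieBracket 𝓘(ℝ, E) V W x)) := by
  rw [← torsionField_apply, ← φ.torsionBilin_apply hV hW]
  exact exteriorPower.alternatingMapLinearEquiv_apply_ιMulti (φ.torsionAlt x) ![V x, W x]

end AltTensor

/-! ### Lie groupoids -/

/-- A Lie groupoid `Γ ⇉ M` with source `src`, target `tgt`, units `unit`, inversion `inv` and
product `mul g h`, which is meaningful only for composable pairs, i.e. when `tgt g = src h`
(the values of `mul` elsewhere are never used).
`M` is modelled on `E` and `Γ` on `F`; no Hausdorff condition is imposed.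
The set of composable pairs is an embedded submanifold of `Γ × Γ` because `src` and `tgt` are
submersions, and smoothness on it is smoothness within this set. -/
structure LieGroupoid (E : Type*) [NormedAddCommGroup E] [NormedSpace ℝ E]
    (M : Type*) [TopologicalSpace M] [ChartedSpace E M] [IsManifold 𝓘(ℝ, E) ∞ M]
    (F : Type*) [NormedAddCommGroup F] [NormedSpace ℝ F]
    (Γ : Type*) [TopologicalSpace Γ] [ChartedSpace F Γ] [IsManifold 𝓘(ℝ, F) ∞ Γ] where
  src : Γ → M
  tgt : Γ → M
  unit : M → Γ
  inv : Γ → Γ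
  mul : Γ → Γ → Γ
  src_mul : ∀ g h, tgt g = src h → src (mul g h) = src g
  tgt_mul : ∀ g h, tgt g = src h → tgt (mul g h) = tgt h
  mul_assoc : ∀ g h k, tgt g = src h → tgt h = src k → mul (mul g h) k = mul g (mul h k)
  src_unit : ∀ x, src (unit x) = x
  tgt_unit : ∀ x, tgt (unit x) = x
  unit_mul : ∀ g, mul (unit (src g)) g = g
  mul_unit : ∀ g, mul g (unit (tgt g)) = g
  src_inv : ∀ g, src (inv g) = tgt g
  tgt_inv : ∀ g, tgt (inv g) = src g
  mul_inv : ∀ g, mul g (inv g) = unit (src g)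
  inv_mul : ∀ g, mul (inv g) g = unit (tgt g)
  smooth_src : ContMDiff 𝓘(ℝ, F) 𝓘(ℝ, E) ∞ src
  smooth_tgt : ContMDiff 𝓘(ℝ, F) 𝓘(ℝ, E) ∞ tgt
  smooth_unit : ContMDiff 𝓘(ℝ, E) 𝓘(ℝ, F) ∞ unit
  smooth_inv : ContMDiff 𝓘(ℝ, F) 𝓘(ℝ, F) ∞ inv
  smooth_mul : ContMDiffOn ((𝓘(ℝ, F)).prod 𝓘(ℝ, F)) 𝓘(ℝ, F) ∞
    (fun p : Γ × Γ => mul p.1 p.2) {p | tgt p.1 = src p.2}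
  submersion_src : ∀ g, Function.Surjective (mfderiv 𝓘(ℝ, F) 𝓘(ℝ, E) src g)
  submersion_tgt : ∀ g, Function.Surjective (mfderiv 𝓘(ℝ, F) 𝓘(ℝ, E) tgt g)

namespace LieGroupoid

variable {E : Type*} [NormedAddCommGroup E] [NormedSpace ℝ E]
  {M : Type*} [TopologicalSpace M] [ChartedSpace E M] [IsManifold 𝓘(ℝ, E) ∞ M]
  {F : Type*} [NormedAddCommGroup F] [NormedSpace ℝ F]
  {Γ : Type*} [TopologicalSpace Γ] [ChartedSpace F Γ] [IsManifold 𝓘(ℝ, F) ∞ Γ]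
  (G : LieGroupoid E M F Γ)

/-- `T_g s` -/
def tangentSrc (g : Γ) :
    TangentSpace 𝓘(ℝ, F) g →ₗ[ℝ] TangentSpace 𝓘(ℝ, E) (G.src g) :=
  (mfderiv 𝓘(ℝ, F) 𝓘(ℝ, E) G.src g).toLinearMap

/-- `T_g t` -/
def tangentTgt (g : Γ) :
    TangentSpace 𝓘(ℝ, F) g →ₗ[ℝ] TangentSpace 𝓘(ℝ, E) (G.tgt g) :=
  (mfderiv 𝓘(ℝ, F) 𝓘(ℝ, E) G.tgt g).toLinearMap

/-- `T_x u` for the unit map `u` -/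
def tangentUnit (x : M) :
    TangentSpace 𝓘(ℝ, E) x →ₗ[ℝ] TangentSpace 𝓘(ℝ, F) (G.unit x) :=
  (mfderiv 𝓘(ℝ, E) 𝓘(ℝ, F) G.unit x).toLinearMap

/-- `T_g ι` for the inversion `ι` -/
def tangentInv (g : Γ) :
    TangentSpace 𝓘(ℝ, F) g →ₗ[ℝ] TangentSpace 𝓘(ℝ, F) (G.inv g) :=
  (mfderiv 𝓘(ℝ, F) 𝓘(ℝ, F) G.inv g).toLinearMap

/-- The set `Γ⁽²⁾` of composable pairs. -/
def composable : Set (Γ × Γ) := {p | G.tgt p.1 = G.src p.2}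

/-- The tangent space of `Γ⁽²⁾` at a composable pair `(g, h)`: the pairs `(u, v)` with
`Tt u = Ts v` in `TM`. -/
def tangentComposable (g h : Γ) (hgh : G.tgt g = G.src h) :
    Submodule ℝ (TangentSpace 𝓘(ℝ, F) g × TangentSpace 𝓘(ℝ, F) h) where
  carrier := {w | (⟨G.tgt g, G.tangentTgt g w.1⟩ : TangentBundle 𝓘(ℝ, E) M) =
    ⟨G.src h, G.tangentSrc h w.2⟩}
  add_mem' {a b} ha hb := by
    simp only [Set.mem_ofPred_eq, Prod.fst_add, Prod.snd_add, map_add] at *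
    revert ha hb
    generalize G.tangentTgt g a.1 = a1
    generalize G.tangentTgt g b.1 = b1
    generalize G.tangentSrc h a.2 = a2
    generalize G.tangentSrc h b.2 = b2
    revert a1 b1
    rw [hgh]
    intro a1 b1 ha hb
    simp only [Bundle.TotalSpace.mk_inj] at ha hb ⊢
    rw [ha, hb]
  zero_mem' := by
    simp only [Set.mem_ofPred_eq, Prod.fst_zero, Prod.snd_zero, map_zero]
    rw [hgh]
  smul_mem' c a ha := by
    simp only [Set.mem_ofPred_eq, Prod.smul_fst, Prod.smul_snd, map_smul] at *
    revert ha
    generalize G.tangentTgt g a.1 = a1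
    generalize G.tangentSrc h a.2 = a2
    revert a1
    rw [hgh]
    intro a1 ha
    simp only [Bundle.TotalSpace.mk_inj] at ha ⊢
    rw [ha]

/-- The projection `T_(g,h) Γ⁽²⁾ → T_g Γ`. -/
def tangentFst (g h : Γ) (hgh : G.tgt g = G.src h) :
    G.tangentComposable g h hgh →ₗ[ℝ] TangentSpace 𝓘(ℝ, F) g :=
  LinearMap.fst ℝ _ _ ∘ₗ (G.tangentComposable g h hgh).subtype

/-- The projection `T_(g,h) Γ⁽²⁾ → T_h Γ`. -/
def tangentSnd (g h : Γ) (hgh : G.tgt g = G.src h) :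
    G.tangentComposable g h hgh →ₗ[ℝ] TangentSpace 𝓘(ℝ, F) h :=
  LinearMap.snd ℝ _ _ ∘ₗ (G.tangentComposable g h hgh).subtype

/-- `Tm : T_(g,h) Γ⁽²⁾ → T_gh Γ`, the differential of the product `m : Γ⁽²⁾ → Γ`, which is also the
product of the tangent groupoid `TΓ ⇉ TM`.  A derivative of `m` within `Γ⁽²⁾` is uniquely
determined on vectors tangent to `Γ⁽²⁾`, and is only applied to those. -/
def tangentMul (g h : Γ) (hgh : G.tgt g = G.src h) :
    G.tangentComposable g h hgh →ₗ[ℝ] TangentSpace 𝓘(ℝ, F) (G.mul g h) :=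
  (mfderivWithin ((𝓘(ℝ, F)).prod 𝓘(ℝ, F)) 𝓘(ℝ, F) (fun p : Γ × Γ => G.mul p.1 p.2)
    G.composable (g, h)).toLinearMap ∘ₗ (G.tangentComposable g h hgh).subtype

end LieGroupoid

/-- A pair `(φ_Γ, φ_M)` of `(k,1)`-tensors is multiplicative if it is a morphism of groupoids from
`∧ᵏ TΓ ⇉ ∧ᵏ TM`, with structure maps `∧ᵏ Ts`, `∧ᵏ Tt`, `∧ᵏ Tu`, `∧ᵏ Tι` and
`∧ᵏ Tm : ∧ᵏ T Γ⁽²⁾ → ∧ᵏ TΓ`, to the tangent groupoid `TΓ ⇉ TM`. -/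
structure LieGroupoid.IsMultiplicative
    {E : Type*} [NormedAddCommGroup E] [NormedSpace ℝ E]
    {M : Type*} [TopologicalSpace M] [ChartedSpace E M] [IsManifold 𝓘(ℝ, E) ∞ M]
    {F : Type*} [NormedAddCommGroup F] [NormedSpace ℝ F]
    {Γ : Type*} [TopologicalSpace Γ] [ChartedSpace F Γ] [IsManifold 𝓘(ℝ, F) ∞ Γ]
    (G : LieGroupoid E M F Γ) {k : ℕ} (φΓ : AltTensor F Γ k) (φM : AltTensor E M k) : Prop where
  map_src : ∀ (g : Γ) (ξ : ⋀[ℝ]^k (TangentSpace 𝓘(ℝ, F) g)),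
    G.tangentSrc g (φΓ.toFun g ξ) = φM.toFun (G.src g) (exteriorPower.map k (G.tangentSrc g) ξ)
  map_tgt : ∀ (g : Γ) (ξ : ⋀[ℝ]^k (TangentSpace 𝓘(ℝ, F) g)),
    G.tangentTgt g (φΓ.toFun g ξ) = φM.toFun (G.tgt g) (exteriorPower.map k (G.tangentTgt g) ξ)
  map_unit : ∀ (x : M) (ξ : ⋀[ℝ]^k (TangentSpace 𝓘(ℝ, E) x)),
    φΓ.toFun (G.unit x) (exteriorPower.map k (G.tangentUnit x) ξ) =
      G.tangentUnit x (φM.toFun x ξ)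
  map_inv : ∀ (g : Γ) (ξ : ⋀[ℝ]^k (TangentSpace 𝓘(ℝ, F) g)),
    φΓ.toFun (G.inv g) (exteriorPower.map k (G.tangentInv g) ξ) = G.tangentInv g (φΓ.toFun g ξ)
  map_mul : ∀ (g h : Γ) (hgh : G.tgt g = G.src h)
    (Ξ : ⋀[ℝ]^k (G.tangentComposable g h hgh)),
    ∃ hc : (φΓ.toFun g (exteriorPower.map k (G.tangentFst g h hgh) Ξ),
        φΓ.toFun h (exteriorPower.map k (G.tangentSnd g h hgh) Ξ)) ∈ G.tangentComposable g h hgh,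
      φΓ.toFun (G.mul g h) (exteriorPower.map k (G.tangentMul g h hgh) Ξ) =
        G.tangentMul g h hgh ⟨_, hc⟩

end

/-! The key fact is naturality of the torsion: if a smooth map `f` satisfies `Tf ∘ φ = ψ ∘ Tf`, then
`Tf` carries the torsion of `φ` to that of `ψ`. No `f`-related vector fields are needed, so `f` need
be neither an immersion nor a submersion. In coordinates the torsion of a field `A` of endomorphisms
involves only `A` and its first derivative; differentiating `Df ∘ A = (B ∘ f) ∘ Df` brings in second
derivatives of `f`, and these cancel by symmetry (`fderiv_localTorsion`). The formula is linked to
the Lie bracket definition by `torsionBilin_eq_localTorsion`, and `mfderiv_torsionBilin` is the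
version for manifolds.

Source, target, units and inversion intertwine the two tensors, so naturality settles them at once.
The product is defined only on `Γ⁽²⁾`, whose tangent spaces are preserved by `φΓ × φΓ`. Since the
target is a submersion, `Γ⁽²⁾` has a local parametrization `p` by a vector space `W`, and `φΓ × φΓ`
pulls back along `p` to a field `A` of endomorphisms of `W` (`exists_parametrization_fiberProduct`).
The two projections and the product, composed with `p`, all intertwine `A` with `φΓ`. Naturality for
these three maps expresses three torsions of `φΓ` through the single vector `localTorsion A 0 a b`,
which gives the product identity (`torsionBilin_mul`). Linearity extends it from decomposable
bivectors to all of them. -/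

/-! ### Torsion and zero sets of submersions in vector spaces -/

section VectorSpace

variable {X : Type*} [NormedAddCommGroup X] [NormedSpace ℝ X]
  {Y : Type*} [NormedAddCommGroup Y] [NormedSpace ℝ Y]

/-- The Nijenhuis torsion of a field of endomorphisms of a vector space, in coordinates. -/
noncomputable def localTorsion (A : X → X →L[ℝ] X) (x v w : X) : X :=
  fderiv ℝ A x (A x v) w - fderiv ℝ A x (A x w) v
    - A x (fderiv ℝ A x v w - fderiv ℝ A x w v)

/-- The Nijenhuis torsion is natural under smooth maps intertwining two `(1,1)`-tensors. -/
theorem fderiv_localTorsion {A : X → X →L[ℝ] X} {B : Y → Y →L[ℝ] Y} {f : X → Y} {x : X}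
    (hA : DifferentiableAt ℝ A x) (hB : DifferentiableAt ℝ B (f x)) (hf : ContDiffAt ℝ 2 f x)
    (h : ∀ᶠ y in 𝓝 x, ∀ z, fderiv ℝ f y (A y z) = B (f y) (fderiv ℝ f y z)) (v w : X) :
    fderiv ℝ f x (localTorsion A x v w) =
      localTorsion B (f x) (fderiv ℝ f x v) (fderiv ℝ f x w) := by
  have hf1 : DifferentiableAt ℝ f x := hf.differentiableAt (by norm_num)
  have hf2 : DifferentiableAt ℝ (fderiv ℝ f) x :=
    (hf.fderiv_right (m := 1) (by norm_num)).differentiableAt (by norm_num)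
  have symm : ∀ a b, fderiv ℝ (fderiv ℝ f) x a b = fderiv ℝ (fderiv ℝ f) x b a :=
    hf.isSymmSndFDerivAt (by simp)
  have h0 : ∀ z, fderiv ℝ f x (A x z) = B (f x) (fderiv ℝ f x z) := h.self_of_nhds
  -- The intertwining relation applied to a fixed `z`, differentiated at `x` in the direction `a`.
  have key : ∀ a z, fderiv ℝ f x (fderiv ℝ A x a z) =
      fderiv ℝ B (f x) (fderiv ℝ f x a) (fderiv ℝ f x z)
        + B (f x) (fderiv ℝ (fderiv ℝ f) x a z) - fderiv ℝ (fderiv ℝ f) x a (A x z) := by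
    intro a z
    have e : (fun y => fderiv ℝ f y (A y z)) =ᶠ[𝓝 x] fun y => B (f y) (fderiv ℝ f y z) := by
      filter_upwards [h] with y hy using hy z
    have hAz := hA.hasFDerivAt.clm_apply (hasFDerivAt_const z x)
    have hfz := hf2.hasFDerivAt.clm_apply (hasFDerivAt_const z x)
    have d1 := hf2.hasFDerivAt.clm_apply hAz
    have d2 := (hB.hasFDerivAt.comp x hf1.hasFDerivAt).clm_apply hfz
    have := DFunLike.congr_fun (d1.unique (d2.congr_of_eventuallyEq e)) a
    simp at this
    rw [← sub_eq_zero] at this ⊢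
    rw [← this]
    abel
  simp only [localTorsion, map_sub, h0, key, map_add]
  -- After these swaps every term with a second derivative of `f` occurs twice with opposite signs.
  rw [symm w (A x v), symm v (A x w), symm w v, symm (A x w) (A x v)]
  abel

/-- A submersion has, near a point of its zero set, a smooth parametrization of this set. -/
theorem exists_parametrization_of_surjective [FiniteDimensional ℝ X] [FiniteDimensional ℝ Y]
    {f : X → Y} {x : X} (hf : ContDiffAt ℝ ∞ f x) (hx : f x = 0)
    (hs : Function.Surjective (fderiv ℝ f x)) :
    ∃ (W : Submodule ℝ X) (P : X →L[ℝ] W) (p : W → X), p 0 = x ∧ ContDiffAt ℝ ∞ p 0 ∧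
      (∀ᶠ w in 𝓝 0, f (p w) = 0) ∧
      ∀ᶠ w in 𝓝 0, ∀ u, fderiv ℝ f (p w) u = 0 → fderiv ℝ p w (P u) = u := by
  have : CompleteSpace X := FiniteDimensional.complete ℝ X
  have : CompleteSpace Y := FiniteDimensional.complete ℝ Y
  set D := fderiv ℝ f x with hD
  have hfd : HasFDerivAt f D x := (hf.differentiableAt (by simp)).hasFDerivAt
  obtain ⟨P₀, hP₀⟩ := D.ker.subtype.exists_leftInverse_of_injective D.ker.ker_subtype
  let P : X →L[ℝ] D.ker := P₀.toContinuousLinearMap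
  have hP : ∀ u : D.ker, P u = u := DFunLike.congr_fun hP₀
  let e : X ≃L[ℝ] Y × D.ker := D.equivProdOfSurjectiveOfIsCompl P
    (LinearMap.range_eq_top.2 hs) (LinearMap.range_eq_top.2 fun u => ⟨u, hP u⟩)
    (LinearMap.isCompl_of_proj hP)
  -- Completing `f` by a projection onto the kernel of its derivative gives a local diffeomorphism
  -- `k`; its inverse `q`, restricted to `{0} × D.ker`, is the parametrization.
  let k : X → Y × D.ker := fun y => (f y, P (y - x))
  have hkd : ∀ y, DifferentiableAt ℝ f y → HasFDerivAt k ((fderiv ℝ f y).prod P) y := fun y hy =>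
    hy.hasFDerivAt.prodMk (P.hasFDerivAt.comp y ((hasFDerivAt_id y).sub_const x))
  have hk : ContDiffAt ℝ ∞ k x :=
    hf.prodMk (P.contDiff.contDiffAt.comp x (contDiffAt_id.sub contDiffAt_const))
  have hk' : HasFDerivAt k (e : X →L[ℝ] Y × D.ker) x := hkd x (hf.differentiableAt (by simp))
  have hkx : k x = 0 := by simp [k, hx]
  have hks := hk.hasStrictFDerivAt' hk' (by simp)
  let q := hk.localInverse hk' (by simp)
  have hq : ContDiffAt ℝ ∞ q 0 := hkx ▸ hk.to_localInverse hk' (by simp)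
  have hq0 : q 0 = x := hkx ▸ hk.localInverse_apply_image hk' (by simp)
  have hr : ∀ᶠ y in 𝓝 0, k (q y) = y := hkx ▸ hks.eventually_right_inverse
  have hl : ∀ᶠ y in 𝓝 x, q (k y) = y := hks.eventually_left_inverse
  let i : D.ker →L[ℝ] Y × D.ker := ContinuousLinearMap.inr ℝ Y D.ker
  have hp : ContDiffAt ℝ ∞ (q ∘ i) 0 := by
    refine ContDiffAt.comp 0 ?_ i.contDiff.contDiffAt
    simpa using hq
  have hi : Filter.Tendsto i (𝓝 0) (𝓝 0) := by simpa using i.continuous.tendsto 0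
  have hpx : Filter.Tendsto (q ∘ i) (𝓝 0) (𝓝 x) := by
    have := hp.continuousAt.tendsto
    simpa [hq0] using this
  refine ⟨D.ker, P, q ∘ i, by simp [hq0], hp, ?_, ?_⟩
  · filter_upwards [hi.eventually hr] with w hw
    exact congrArg Prod.fst hw
  · have hfdiff : ∀ᶠ y in 𝓝 x, DifferentiableAt ℝ f y :=
      ((hf.of_le (m := 1) (by simp)).eventually (by simp)).mono fun y hy =>
        hy.differentiableAt (by simp)
    have hqdiff : ∀ᶠ y in 𝓝 0, DifferentiableAt ℝ q y :=
      ((hq.of_le (m := 1) (by simp)).eventually (by simp)).mono fun y hy =>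
        hy.differentiableAt (by simp)
    -- Differentiating `q ∘ k = id` at `p w` gives `Dq (Df u, P u) = u`; when `Df u = 0` the left
    -- side is `Dp (P u)`.
    filter_upwards [hi.eventually hr, hpx.eventually hl.eventually_nhds, hpx.eventually hfdiff,
      hi.eventually hqdiff] with w hw hlw hfw hqw u hu
    have h1 : HasFDerivAt q (fderiv ℝ q (i w)) (k (q (i w))) := by
      rw [hw]; exact hqw.hasFDerivAt
    have h2 := h1.comp (q (i w)) (hkd (q (i w)) hfw)
    have h3 := DFunLike.congr_fun
      (h2.unique ((hasFDerivAt_id (q (i w))).congr_of_eventuallyEq hlw)) u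
    have h4 : fderiv ℝ (q ∘ i) w = (fderiv ℝ q (i w)).comp i :=
      (hqw.hasFDerivAt.comp w i.hasFDerivAt).fderiv
    rw [h4]
    have hu' : fderiv ℝ f (q (0, w)) u = 0 := hu
    simpa [i, hu'] using h3

end VectorSpace

/-! ### The torsion of a tensor in the preferred chart -/

namespace AltTensor

variable {E : Type*} [NormedAddCommGroup E] [NormedSpace ℝ E] [FiniteDimensional ℝ E]
  {M : Type*} [TopologicalSpace M] [ChartedSpace E M] [IsManifold 𝓘(ℝ, E) ∞ M]

/-- A `(1,1)`-tensor near `x₀`, read in the preferred trivialization at `x₀`. -/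
noncomputable def coordEndo (φ : AltTensor E M 1) (x₀ x : M) : E →L[ℝ] E :=
  have : IsManifold 𝓘(ℝ, E) 1 M := IsManifold.of_le (n := ∞) (by norm_cast)
  LinearMap.toContinuousLinearMap
    (((trivializationAt E (TangentSpace 𝓘(ℝ, E)) x₀).continuousLinearMapAt ℝ x).toLinearMap ∘ₗ
      φ.endo x ∘ₗ ((trivializationAt E (TangentSpace 𝓘(ℝ, E)) x₀).symmL ℝ x).toLinearMap)

lemma coordEndo_mfderiv (φ : AltTensor E M 1) {x₀ x : M} (hx : x ∈ (chartAt E x₀).source)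
    (v : TangentSpace 𝓘(ℝ, E) x) :
    φ.coordEndo x₀ x (mfderiv 𝓘(ℝ, E) 𝓘(ℝ, E) (extChartAt 𝓘(ℝ, E) x₀) x v) =
      mfderiv 𝓘(ℝ, E) 𝓘(ℝ, E) (extChartAt 𝓘(ℝ, E) x₀) x (φ.endo x v) := by
  have : IsManifold 𝓘(ℝ, E) 1 M := IsManifold.of_le (n := ∞) (by norm_cast)
  rw [← TangentBundle.continuousLinearMapAt_trivializationAt (I := 𝓘(ℝ, E)) hx]
  have := (trivializationAt E (TangentSpace 𝓘(ℝ, E)) x₀).symmL_continuousLinearMapAt (R := ℝ)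
    (b := x) hx v
  simp only [coordEndo]
  exact congrArg (fun z => (trivializationAt E (TangentSpace 𝓘(ℝ, E)) x₀).continuousLinearMapAt ℝ x
    (φ.endo x z)) this

-- Fields with constant coefficients in the trivialization are the test fields, both for the
-- smoothness of `coordEndo` and for evaluating the torsion.
omit [FiniteDimensional ℝ E] in
lemma contMDiffOn_symmL (x₀ : M) (v : E) :
    have : IsManifold 𝓘(ℝ, E) 1 M := IsManifold.of_le (n := ∞) (by norm_cast)
    CMDiff[(chartAt E x₀).source] ∞
      (T% (fun x => (trivializationAt E (TangentSpace 𝓘(ℝ, E)) x₀).symmL ℝ x v)) := by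
  have : IsManifold 𝓘(ℝ, E) 1 M := IsManifold.of_le (n := ∞) (by norm_cast)
  have : IsManifold 𝓘(ℝ, E) (∞ + 1) M := inferInstanceAs (IsManifold 𝓘(ℝ, E) ∞ M)
  refine ((trivializationAt E (TangentSpace 𝓘(ℝ, E)) x₀).contMDiffOn_section_baseSet_iff).2 ?_
  refine (contMDiffOn_const (c := v)).congr fun y hy => ?_
  have := (trivializationAt E (TangentSpace 𝓘(ℝ, E)) x₀).continuousLinearMapAt_symmL (R := ℝ) hy v
  rwa [Bundle.Trivialization.continuousLinearMapAt_apply,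
    Bundle.Trivialization.coe_linearMapAt_of_mem _ hy] at this

lemma coordEndo_contMDiffOn (φ : AltTensor E M 1) (x₀ : M) (v : E) :
    CMDiff[(chartAt E x₀).source] ∞ (fun x => φ.coordEndo x₀ x v) := by
  have : IsManifold 𝓘(ℝ, E) 1 M := IsManifold.of_le (n := ∞) (by norm_cast)
  have : IsManifold 𝓘(ℝ, E) (∞ + 1) M := inferInstanceAs (IsManifold 𝓘(ℝ, E) ∞ M)
  have h := φ.onField_smoothOn (chartAt E x₀).open_source (contMDiffOn_symmL x₀ v)
  refine (((trivializationAt E (TangentSpace 𝓘(ℝ, E)) x₀).contMDiffOn_section_baseSet_iff).1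
    h).congr fun y hy => ?_
  exact congrFun
    ((trivializationAt E (TangentSpace 𝓘(ℝ, E)) x₀).coe_linearMapAt_of_mem (R := ℝ) hy) _

lemma coordEndo_contDiffAt (φ : AltTensor E M 1) (x₀ : M) :
    ContDiffAt ℝ ∞ (fun y => φ.coordEndo x₀ ((extChartAt 𝓘(ℝ, E) x₀).symm y))
      (extChartAt 𝓘(ℝ, E) x₀ x₀) := by
  have h : ContDiffOn ℝ ∞ (fun y => φ.coordEndo x₀ ((extChartAt 𝓘(ℝ, E) x₀).symm y))
      (extChartAt 𝓘(ℝ, E) x₀).target := by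
    -- In finite dimension a family of operators is smooth as soon as its values on each fixed
    -- vector are.
    rw [contDiffOn_clm_apply]
    intro v
    refine contMDiffOn_iff_contDiffOn.1 ?_
    refine (φ.coordEndo_contMDiffOn x₀ v).comp (contMDiffOn_extChartAt_symm x₀) fun y hy => ?_
    simpa using (extChartAt 𝓘(ℝ, E) x₀).map_target hy
  exact h.contDiffAt (extChartAt_target_mem_nhds x₀)

omit [FiniteDimensional ℝ E] in
/-- The Lie bracket at `x₀` of two vector fields, computed in the preferred chart at `x₀`. -/
lemma mlieBracket_eq_of_extChartAt {x₀ : M} {V W : ∀ x : M, TangentSpace 𝓘(ℝ, E) x} {V' W' : E → E}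
    (hV : ∀ x ∈ (chartAt E x₀).source,
      mfderiv 𝓘(ℝ, E) 𝓘(ℝ, E) (extChartAt 𝓘(ℝ, E) x₀) x (V x) = V' (extChartAt 𝓘(ℝ, E) x₀ x))
    (hW : ∀ x ∈ (chartAt E x₀).source,
      mfderiv 𝓘(ℝ, E) 𝓘(ℝ, E) (extChartAt 𝓘(ℝ, E) x₀) x (W x) = W' (extChartAt 𝓘(ℝ, E) x₀ x)) :
    VectorField.mlieBracket 𝓘(ℝ, E) V W x₀ =
      fderiv ℝ W' (extChartAt 𝓘(ℝ, E) x₀ x₀) (V' (extChartAt 𝓘(ℝ, E) x₀ x₀))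
        - fderiv ℝ V' (extChartAt 𝓘(ℝ, E) x₀ x₀) (W' (extChartAt 𝓘(ℝ, E) x₀ x₀)) := by
  have : IsManifold 𝓘(ℝ, E) 1 M := IsManifold.of_le (n := ∞) (by norm_cast)
  have pull : ∀ (V : ∀ x : M, TangentSpace 𝓘(ℝ, E) x) (V' : E → E),
      (∀ x ∈ (chartAt E x₀).source,
        mfderiv 𝓘(ℝ, E) 𝓘(ℝ, E) (extChartAt 𝓘(ℝ, E) x₀) x (V x) = V' (extChartAt 𝓘(ℝ, E) x₀ x)) →
      VectorField.mpullbackWithin 𝓘(ℝ, E) 𝓘(ℝ, E) (extChartAt 𝓘(ℝ, E) x₀).symm V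
        (Set.range 𝓘(ℝ, E)) =ᶠ[𝓝 (extChartAt 𝓘(ℝ, E) x₀ x₀)] V' := by
    intro V V' hV
    filter_upwards [extChartAt_target_mem_nhds (I := 𝓘(ℝ, E)) x₀] with y hy
    have hy' := (extChartAt 𝓘(ℝ, E) x₀).map_target hy
    have hm : (extChartAt 𝓘(ℝ, E) x₀).symm y ∈ (chartAt E x₀).source := by
      rwa [extChartAt_source] at hy'
    have := hV _ hm
    rw [(extChartAt 𝓘(ℝ, E) x₀).right_inv hy] at this
    rw [VectorField.mpullbackWithin_apply, ← this, ContinuousLinearMap.inverse_eq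
      (mfderivWithin_extChartAt_symm_comp_mfderiv_extChartAt hy)
      (mfderiv_extChartAt_comp_mfderivWithin_extChartAt_symm hy)]
  -- The tangent space at `x₀` is identified with `E` through the preferred chart at `x₀`, so the
  -- derivative of this chart there is the identity.
  have hinv : ∀ a : E, (mfderiv 𝓘(ℝ, E) 𝓘(ℝ, E) (extChartAt 𝓘(ℝ, E) x₀) x₀).inverse a = a := by
    intro a
    rw [mfderiv_extChartAt_self]
    exact DFunLike.congr_fun (ContinuousLinearMap.inverse_eq (f := .id ℝ E) (g := .id ℝ E) rfl rfl) a
  rw [VectorField.mlieBracket, VectorField.mlieBracketWithin_apply]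
  refine (hinv _).trans ?_
  have h := (pull V V' hV).lieBracketWithin_vectorField_eq_nhds (𝕜 := ℝ) (s := Set.univ) (pull W W' hW)
  rw [VectorField.lieBracketWithin_univ] at h
  simpa using! h

/-- By tensoriality the torsion may be evaluated on the constant-coefficient fields through `v` and
`w`. Their bracket vanishes, and the other three brackets only differentiate the coordinate
representation of `φ`. -/
lemma torsionBilin_eq_localTorsion (φ : AltTensor E M 1) (x₀ : M) (v w : E) :
    φ.torsionBilin x₀ v w =
      localTorsion (fun y => φ.coordEndo x₀ ((extChartAt 𝓘(ℝ, E) x₀).symm y))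
        (extChartAt 𝓘(ℝ, E) x₀ x₀) v w := by
  have : IsManifold 𝓘(ℝ, E) 1 M := IsManifold.of_le (n := ∞) (by norm_cast)
  have hx₀ : x₀ ∈ (chartAt E x₀).source := mem_chart_source E x₀
  have hdc : ∀ x ∈ (chartAt E x₀).source,
      mfderiv 𝓘(ℝ, E) 𝓘(ℝ, E) (extChartAt 𝓘(ℝ, E) x₀) x =
        (trivializationAt E (TangentSpace 𝓘(ℝ, E)) x₀).continuousLinearMapAt ℝ x := fun x hx =>
    (TangentBundle.continuousLinearMapAt_trivializationAt hx).symm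
  have hid : ∀ a : E, mfderiv 𝓘(ℝ, E) 𝓘(ℝ, E) (extChartAt 𝓘(ℝ, E) x₀) x₀ a = a := fun a => by
    rw [mfderiv_extChartAt_self]; rfl
  have hend : ∀ x ∈ (chartAt E x₀).source, ∀ a : TangentSpace 𝓘(ℝ, E) x,
      φ.coordEndo x₀ x (mfderiv 𝓘(ℝ, E) 𝓘(ℝ, E) (extChartAt 𝓘(ℝ, E) x₀) x a) =
      mfderiv 𝓘(ℝ, E) 𝓘(ℝ, E) (extChartAt 𝓘(ℝ, E) x₀) x (φ.endo x a) :=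
    fun x hx a => φ.coordEndo_mfderiv hx a
  have hbr := @mlieBracket_eq_of_extChartAt E _ _ M _ _ _ x₀
  set t := trivializationAt E (TangentSpace 𝓘(ℝ, E)) x₀ with ht
  set c := extChartAt 𝓘(ℝ, E) x₀ with hc
  set B : E → E →L[ℝ] E := fun y => φ.coordEndo x₀ (c.symm y) with hB
  have hBd : DifferentiableAt ℝ B (c x₀) :=
    (φ.coordEndo_contDiffAt x₀).differentiableAt (by simp)
  have hBc : ∀ x ∈ (chartAt E x₀).source, B (c x) = φ.coordEndo x₀ x := fun x hx => by
    simp only [hB, c.left_inv (show x ∈ c.source by simpa [hc] using hx)]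
  let Z : E → ∀ x : M, TangentSpace 𝓘(ℝ, E) x := fun a x => t.symmL ℝ x a
  have hZ : ∀ a, MDiffAt (T% (Z a)) x₀ := fun a =>
    ((contMDiffOn_symmL x₀ a).contMDiffAt
      ((chartAt E x₀).open_source.mem_nhds hx₀)).mdifferentiableAt (by simp)
  have h1 : ∀ a, ∀ x ∈ (chartAt E x₀).source, mfderiv 𝓘(ℝ, E) 𝓘(ℝ, E) c x (Z a x) = a :=
    fun a x hx => by
      rw [hdc x hx]
      exact t.continuousLinearMapAt_symmL hx a
  have h2 : ∀ a, ∀ x ∈ (chartAt E x₀).source,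
      mfderiv 𝓘(ℝ, E) 𝓘(ℝ, E) c x (φ.onField (Z a) x) = B (c x) a := fun a x hx => by
    have := hend x hx (Z a x)
    rw [h1 a x hx] at this
    rw [hBc x hx, this, onField]
  have hself : ∀ a : E, Z a x₀ = a := fun a => by
    rw [← hid (Z a x₀), h1 a x₀ hx₀]
  have hφ : ∀ a : E, φ.endo x₀ a = B (c x₀) a := fun a => by
    have := hend x₀ hx₀ a
    rw [hid a] at this
    rw [hBc x₀ hx₀, this]
    exact (hid _).symm
  have hd : ∀ a b : E, fderiv ℝ (fun y => B y a) (c x₀) b = fderiv ℝ B (c x₀) b a := fun a b => by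
    have := hBd.hasFDerivAt.clm_apply (hasFDerivAt_const a (c x₀))
    rw [this.fderiv]
    simp
  have key := φ.torsionBilin_apply (hZ v) (hZ w)
  have hv := hself v
  have hw := hself w
  rw [torsionField_apply, hbr (V' := fun y => B y v) (W' := fun y => B y w) (h2 v) (h2 w),
    hbr (V' := fun y => B y v) (W' := fun _ => w) (h2 v) (h1 w),
    hbr (V' := fun _ => v) (W' := fun y => B y w) (h1 v) (h2 w),
    hbr (V' := fun _ => v) (W' := fun _ => w) (h1 v) (h1 w)] at key
  erw [hv, hw] at key
  rw [key]
  have e0 : φ.endo x₀ (0 : E) = (0 : E) := map_zero _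
  simp only [localTorsion, fderiv_fun_const, Pi.zero_apply, zero_apply, hd, zero_sub, sub_zero,
    sub_self]
  erw [e0, hφ]
  refine congrArg₂ (· - ·) rfl (congrArg (B (c x₀)) ?_)
  have e (a b : E) : -a + b - 0 = b - a := by abel
  exact e _ _

end AltTensor

/-! ### Naturality of the torsion on manifolds -/

namespace AltTensor

variable {X : Type*} [NormedAddCommGroup X] [NormedSpace ℝ X]
  {E : Type*} [NormedAddCommGroup E] [NormedSpace ℝ E] [FiniteDimensional ℝ E]
  {M : Type*} [TopologicalSpace M] [ChartedSpace E M] [IsManifold 𝓘(ℝ, E) ∞ M]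
  {E' : Type*} [NormedAddCommGroup E'] [NormedSpace ℝ E'] [FiniteDimensional ℝ E']
  {N : Type*} [TopologicalSpace N] [ChartedSpace E' N] [IsManifold 𝓘(ℝ, E') ∞ N]

/-- Naturality of the torsion under a smooth map from a vector space to a manifold. -/
theorem mfderiv_localTorsion (φ : AltTensor E M 1) {A : X → X →L[ℝ] X} {x : X} {f : X → M}
    (hA : DifferentiableAt ℝ A x) (hf : ContMDiffAt 𝓘(ℝ, X) 𝓘(ℝ, E) ∞ f x)
    (h : ∀ᶠ y in 𝓝 x, ∀ z : X, mfderiv 𝓘(ℝ, X) 𝓘(ℝ, E) f y (A y z) =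
      φ.endo (f y) (mfderiv 𝓘(ℝ, X) 𝓘(ℝ, E) f y z)) (v w : X) :
    mfderiv 𝓘(ℝ, X) 𝓘(ℝ, E) f x (localTorsion (X := X) A x v w) =
      φ.torsionBilin (f x) (mfderiv 𝓘(ℝ, X) 𝓘(ℝ, E) f x v)
        (mfderiv 𝓘(ℝ, X) 𝓘(ℝ, E) f x w) := by
  have : IsManifold 𝓘(ℝ, E) 1 M := IsManifold.of_le (n := ∞) (by norm_cast)
  have hs : ∀ᶠ y in 𝓝 x, f y ∈ (chartAt E (f x)).source :=
    hf.continuousAt.eventually ((chartAt E (f x)).open_source.mem_nhds (mem_chart_source E (f x)))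
  have hfd : ∀ᶠ y in 𝓝 x, MDifferentiableAt 𝓘(ℝ, X) 𝓘(ℝ, E) f y :=
    (contMDiffAt_iff_contMDiffAt_nhds (by simp)).1
      (hf.of_le (n := ∞) (m := 1) (by norm_cast)) |>.mono fun y hy => hy.mdifferentiableAt (by simp)
  have hcomp : ∀ᶠ y in 𝓝 x, ∀ z : X, fderiv ℝ (extChartAt 𝓘(ℝ, E) (f x) ∘ f) y z =
      mfderiv 𝓘(ℝ, E) 𝓘(ℝ, E) (extChartAt 𝓘(ℝ, E) (f x)) (f y)
        (mfderiv 𝓘(ℝ, X) 𝓘(ℝ, E) f y z) := by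
    filter_upwards [hs, hfd] with y hy hfy z
    have := mfderiv_comp y (mdifferentiableAt_extChartAt (I := 𝓘(ℝ, E)) hy) hfy
    rw [← mfderiv_eq_fderiv, this]
    rfl
  have hx : ∀ z : X, fderiv ℝ (extChartAt 𝓘(ℝ, E) (f x) ∘ f) x z =
      mfderiv 𝓘(ℝ, X) 𝓘(ℝ, E) f x z := by
    intro z
    rw [hcomp.self_of_nhds z, mfderiv_extChartAt_self]
    rfl
  have hF : ContDiffAt ℝ ∞ (extChartAt 𝓘(ℝ, E) (f x) ∘ f) x :=
    contMDiffAt_iff_contDiffAt.1 (contMDiffAt_extChartAt.comp x hf)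
  -- The vector space case, applied to `f` read in the chart at `f x`. By `hx` this composite has
  -- the same derivative at `x` as `f`, so nothing has to be translated back.
  have key := fderiv_localTorsion (f := extChartAt 𝓘(ℝ, E) (f x) ∘ f) hA
    ((φ.coordEndo_contDiffAt (f x)).differentiableAt (by simp)) (hF.of_le (by norm_cast)) (by
      filter_upwards [hs, hcomp, h] with y hy hcy hhy z
      have e : (extChartAt 𝓘(ℝ, E) (f x)).symm (extChartAt 𝓘(ℝ, E) (f x) (f y)) = f y :=
        (extChartAt 𝓘(ℝ, E) (f x)).left_inv (by rwa [extChartAt_source])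
      simp only [Function.comp_apply, e]
      rw [hcy, hcy, hhy]
      exact (φ.coordEndo_mfderiv hy _).symm) v w
  rw [hx] at key
  refine key.trans ?_
  rw [hx, hx]
  exact (φ.torsionBilin_eq_localTorsion (f x) _ _).symm

/-- `mfderiv_localTorsion`, with the derivative and the value of the map given up to equality. -/
theorem hasMFDerivAt_localTorsion (φ : AltTensor E M 1) {A : X → X →L[ℝ] X} {x : X} {f : X → M}
    (hA : DifferentiableAt ℝ A x) (hf : ContMDiffAt 𝓘(ℝ, X) 𝓘(ℝ, E) ∞ f x)
    (h : ∀ᶠ y in 𝓝 x, ∀ z : X, mfderiv 𝓘(ℝ, X) 𝓘(ℝ, E) f y (A y z) =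
      φ.endo (f y) (mfderiv 𝓘(ℝ, X) 𝓘(ℝ, E) f y z))
    {D : X →L[ℝ] E} (hD : HasMFDerivAt 𝓘(ℝ, X) 𝓘(ℝ, E) f x D) {q : M} (hq : f x = q) (v w : X) :
    D (localTorsion A x v w) = φ.torsionBilin q (D v) (D w) := by
  subst hq
  have := φ.mfderiv_localTorsion hA hf h v w
  rw [hD.mfderiv] at this
  exact this

/-- The inverse of a chart intertwines a tensor with its coordinate representation. -/
lemma mfderiv_extChartAt_symm_coordEndo (φ : AltTensor E M 1) (x₀ : M) {y : E}
    (hy : y ∈ (extChartAt 𝓘(ℝ, E) x₀).target) (z : E) :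
    mfderiv 𝓘(ℝ, E) 𝓘(ℝ, E) (extChartAt 𝓘(ℝ, E) x₀).symm y
        (φ.coordEndo x₀ ((extChartAt 𝓘(ℝ, E) x₀).symm y) z) =
      φ.endo ((extChartAt 𝓘(ℝ, E) x₀).symm y)
        (mfderiv 𝓘(ℝ, E) 𝓘(ℝ, E) (extChartAt 𝓘(ℝ, E) x₀).symm y z) := by
  have : IsManifold 𝓘(ℝ, E) 1 M := IsManifold.of_le (n := ∞) (by norm_cast)
  have hm := (extChartAt 𝓘(ℝ, E) x₀).map_target hy
  rw [extChartAt_source] at hm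
  have h1 := mfderivWithin_extChartAt_symm_comp_mfderiv_extChartAt hy
  have h2 := mfderiv_extChartAt_comp_mfderivWithin_extChartAt_symm hy
  simp only [modelWithCornersSelf_coe, Set.range_id, mfderivWithin_univ] at h1 h2
  have h3 := φ.coordEndo_mfderiv hm
    (mfderiv 𝓘(ℝ, E) 𝓘(ℝ, E) (extChartAt 𝓘(ℝ, E) x₀).symm y z)
  have h4 := DFunLike.congr_fun h2 z
  have h5 := DFunLike.congr_fun h1 (φ.endo ((extChartAt 𝓘(ℝ, E) x₀).symm y)
        (mfderiv 𝓘(ℝ, E) 𝓘(ℝ, E) (extChartAt 𝓘(ℝ, E) x₀).symm y z))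
  refine Eq.trans ?_ h5
  refine congrArg (mfderiv 𝓘(ℝ, E) 𝓘(ℝ, E) (extChartAt 𝓘(ℝ, E) x₀).symm y) ?_
  refine Eq.trans ?_ h3
  exact congrArg (φ.coordEndo x₀ _) h4.symm

omit [FiniteDimensional ℝ E] in
lemma hasMFDerivAt_extChartAt_symm (x₀ : M) :
    HasMFDerivAt 𝓘(ℝ, E) 𝓘(ℝ, E) (extChartAt 𝓘(ℝ, E) x₀).symm (extChartAt 𝓘(ℝ, E) x₀ x₀)
      (ContinuousLinearMap.id ℝ E) := by
  have : IsManifold 𝓘(ℝ, E) 1 M := IsManifold.of_le (n := ∞) (by norm_cast)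
  have h1 := mfderivWithin_range_extChartAt_symm (I := 𝓘(ℝ, E)) (x := x₀)
  simp only [modelWithCornersSelf_coe, Set.range_id, mfderivWithin_univ] at h1
  have h2 : MDifferentiableAt 𝓘(ℝ, E) 𝓘(ℝ, E) (extChartAt 𝓘(ℝ, E) x₀).symm
      (extChartAt 𝓘(ℝ, E) x₀ x₀) := by
    have := mdifferentiableWithinAt_extChartAt_symm (I := 𝓘(ℝ, E))
      (mem_extChartAt_target (I := 𝓘(ℝ, E)) x₀)
    rwa [modelWithCornersSelf_coe, Set.range_id, mdifferentiableWithinAt_univ] at this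
  have h3 := h2.hasMFDerivAt
  rw [h1] at h3
  exact h3

omit [FiniteDimensional ℝ E] in
lemma contMDiffAt_extChartAt_symm (x₀ : M) {y : E} (hy : y ∈ (extChartAt 𝓘(ℝ, E) x₀).target) :
    ContMDiffAt 𝓘(ℝ, E) 𝓘(ℝ, E) ∞ (extChartAt 𝓘(ℝ, E) x₀).symm y :=
  (contMDiffOn_extChartAt_symm x₀).contMDiffAt ((isOpen_extChartAt_target x₀).mem_nhds hy)

/-- Naturality of the torsion under a smooth map intertwining two `(1,1)`-tensors. -/
theorem mfderiv_torsionBilin (φ : AltTensor E M 1) (ψ : AltTensor E' N 1) {f : M → N} 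
    (hf : ContMDiff 𝓘(ℝ, E) 𝓘(ℝ, E') ∞ f)
    (h : ∀ y, ∀ z : TangentSpace 𝓘(ℝ, E) y, mfderiv 𝓘(ℝ, E) 𝓘(ℝ, E') f y (φ.endo y z) =
      ψ.endo (f y) (mfderiv 𝓘(ℝ, E) 𝓘(ℝ, E') f y z)) (x : M) (v w : TangentSpace 𝓘(ℝ, E) x) :
    mfderiv 𝓘(ℝ, E) 𝓘(ℝ, E') f x (φ.torsionBilin x v w) =
      ψ.torsionBilin (f x) (mfderiv 𝓘(ℝ, E) 𝓘(ℝ, E') f x v)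
        (mfderiv 𝓘(ℝ, E) 𝓘(ℝ, E') f x w) := by
  have hx : (extChartAt 𝓘(ℝ, E) x).symm (extChartAt 𝓘(ℝ, E) x x) = x := extChartAt_to_inv x
  have hfd : MDifferentiable 𝓘(ℝ, E) 𝓘(ℝ, E') f := hf.mdifferentiable (by simp)
  have hD : HasMFDerivAt 𝓘(ℝ, E) 𝓘(ℝ, E') (f ∘ (extChartAt 𝓘(ℝ, E) x).symm)
      (extChartAt 𝓘(ℝ, E) x x) (mfderiv 𝓘(ℝ, E) 𝓘(ℝ, E') f x : E →L[ℝ] E') := by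
    have h1 : HasMFDerivAt 𝓘(ℝ, E) 𝓘(ℝ, E') f
        ((extChartAt 𝓘(ℝ, E) x).symm (extChartAt 𝓘(ℝ, E) x x))
        (mfderiv 𝓘(ℝ, E) 𝓘(ℝ, E') f x : E →L[ℝ] E') := by
      -- The base point is `x` only up to a propositional equality, hence the free `y`.
      have : ∀ y, y = x → HasMFDerivAt 𝓘(ℝ, E) 𝓘(ℝ, E') f y
        (mfderiv 𝓘(ℝ, E) 𝓘(ℝ, E') f x : E →L[ℝ] E') := by
        rintro _ rfl
        exact (hfd _).hasMFDerivAt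
      exact this _ hx
    exact h1.comp _ (hasMFDerivAt_extChartAt_symm x)
  -- Precomposing with the inverse chart makes the source a vector space, where `φ` becomes the
  -- field `coordEndo`.
  have key := ψ.hasMFDerivAt_localTorsion (f := f ∘ (extChartAt 𝓘(ℝ, E) x).symm)
    ((φ.coordEndo_contDiffAt x).differentiableAt (by simp))
    (hf.contMDiffAt.comp _ (contMDiffAt_extChartAt_symm x (mem_extChartAt_target x))) (by
      filter_upwards [extChartAt_target_mem_nhds (I := 𝓘(ℝ, E)) x] with y hy z
      have := (contMDiffAt_extChartAt_symm x hy).mdifferentiableAt (by simp)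
      rw [mfderiv_comp y (hfd _) this]
      have h1 := φ.mfderiv_extChartAt_symm_coordEndo x hy z
      have h2 := h ((extChartAt 𝓘(ℝ, E) x).symm y)
        (mfderiv 𝓘(ℝ, E) 𝓘(ℝ, E) (extChartAt 𝓘(ℝ, E) x).symm y z)
      rw [← h1] at h2
      exact h2) hD (congrArg f hx) v w
  rw [← φ.torsionBilin_eq_localTorsion x v w] at key
  exact key

end AltTensor

/-! ### Intertwining maps read in charts -/

namespace AltTensor

variable {E : Type*} [NormedAddCommGroup E] [NormedSpace ℝ E] [FiniteDimensional ℝ E]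
  {M : Type*} [TopologicalSpace M] [ChartedSpace E M] [IsManifold 𝓘(ℝ, E) ∞ M]
  {E' : Type*} [NormedAddCommGroup E'] [NormedSpace ℝ E'] [FiniteDimensional ℝ E']
  {N : Type*} [TopologicalSpace N] [ChartedSpace E' N] [IsManifold 𝓘(ℝ, E') ∞ N]

-- The value `f x` is replaced by an equal point `q` because the target at `g` and the source at
-- `h`, equal only propositionally, have to be read in one and the same chart of the base.
omit [FiniteDimensional ℝ E] [FiniteDimensional ℝ E'] [IsManifold 𝓘(ℝ, E) ∞ M]
  [IsManifold 𝓘(ℝ, E') ∞ N] in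
lemma hasFDerivAt_extChartAt_comp {f : M → N} {x : M} {q : N} (hq : f x = q) {D : E →L[ℝ] E'}
    (hD : HasMFDerivAt 𝓘(ℝ, E) 𝓘(ℝ, E') f x D) :
    HasFDerivAt (extChartAt 𝓘(ℝ, E') q ∘ f ∘ (extChartAt 𝓘(ℝ, E) x).symm) D
      (extChartAt 𝓘(ℝ, E) x x) := by
  subst hq
  have := hD.2
  rw [modelWithCornersSelf_coe, Set.range_id] at this
  exact HasFDerivWithinAt.hasFDerivAt_of_univ this

omit [FiniteDimensional ℝ E] [FiniteDimensional ℝ E'] [IsManifold 𝓘(ℝ, E) ∞ M]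
  [IsManifold 𝓘(ℝ, E') ∞ N] in
lemma contDiffAt_extChartAt_comp {f : M → N} {x : M} {q : N} (hq : f x = q)
    (hf : ContMDiff 𝓘(ℝ, E) 𝓘(ℝ, E') ∞ f) :
    ContDiffAt ℝ ∞ (extChartAt 𝓘(ℝ, E') q ∘ f ∘ (extChartAt 𝓘(ℝ, E) x).symm)
      (extChartAt 𝓘(ℝ, E) x x) := by
  subst hq
  have := contMDiffAt_iff.1 (hf x) |>.2
  rwa [modelWithCornersSelf_coe, Set.range_id, contDiffWithinAt_univ] at this

omit [FiniteDimensional ℝ E] [NormedSpace ℝ E'] [FiniteDimensional ℝ E']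
  [IsManifold 𝓘(ℝ, E) ∞ M] [IsManifold 𝓘(ℝ, E') ∞ N] in
lemma eventually_mem_chartAt_source {f : M → N} {x : M} {q : N} (hq : f x = q)
    (hf : Continuous f) :
    ∀ᶠ y in 𝓝 (extChartAt 𝓘(ℝ, E) x x),
      f ((extChartAt 𝓘(ℝ, E) x).symm y) ∈ (chartAt E' q).source := by
  have h := hf.continuousAt.comp (continuousAt_extChartAt_symm (I := 𝓘(ℝ, E)) x)
  refine h.eventually ((chartAt E' q).open_source.mem_nhds ?_)
  simp [hq]

/-- A map intertwining two tensors intertwines their coordinate representations. -/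
lemma eventually_fderiv_coordEndo (φ : AltTensor E M 1) (ψ : AltTensor E' N 1) {f : M → N}
    (hf : ContMDiff 𝓘(ℝ, E) 𝓘(ℝ, E') ∞ f)
    (h : ∀ y, ∀ z : TangentSpace 𝓘(ℝ, E) y, mfderiv 𝓘(ℝ, E) 𝓘(ℝ, E') f y (φ.endo y z) =
      ψ.endo (f y) (mfderiv 𝓘(ℝ, E) 𝓘(ℝ, E') f y z)) {x : M} {q : N} (hq : f x = q) :
    ∀ᶠ y in 𝓝 (extChartAt 𝓘(ℝ, E) x x), ∀ z,
      fderiv ℝ (extChartAt 𝓘(ℝ, E') q ∘ f ∘ (extChartAt 𝓘(ℝ, E) x).symm) y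
          (φ.coordEndo x ((extChartAt 𝓘(ℝ, E) x).symm y) z) =
        ψ.coordEndo q (f ((extChartAt 𝓘(ℝ, E) x).symm y))
          (fderiv ℝ (extChartAt 𝓘(ℝ, E') q ∘ f ∘ (extChartAt 𝓘(ℝ, E) x).symm) y z) := by
  have : IsManifold 𝓘(ℝ, E') 1 N := IsManifold.of_le (n := ∞) (by norm_cast)
  filter_upwards [extChartAt_target_mem_nhds (I := 𝓘(ℝ, E)) x,
    eventually_mem_chartAt_source (E := E) (E' := E') hq hf.continuous] with y hy hfy z
  have h1 := (contMDiffAt_extChartAt_symm x hy).mdifferentiableAt (by simp)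
  have h2 := hf.mdifferentiable (by simp) ((extChartAt 𝓘(ℝ, E) x).symm y)
  have h3 := mdifferentiableAt_extChartAt (I := 𝓘(ℝ, E')) hfy
  have hc : ∀ a : E, fderiv ℝ (extChartAt 𝓘(ℝ, E') q ∘ f ∘ (extChartAt 𝓘(ℝ, E) x).symm) y a =
      mfderiv 𝓘(ℝ, E') 𝓘(ℝ, E') (extChartAt 𝓘(ℝ, E') q) (f ((extChartAt 𝓘(ℝ, E) x).symm y))
        (mfderiv 𝓘(ℝ, E) 𝓘(ℝ, E') f ((extChartAt 𝓘(ℝ, E) x).symm y)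
          (mfderiv 𝓘(ℝ, E) 𝓘(ℝ, E) (extChartAt 𝓘(ℝ, E) x).symm y a)) := by
    intro a
    have := h3.hasMFDerivAt.comp y (h2.hasMFDerivAt.comp y h1.hasMFDerivAt)
    rw [← mfderiv_eq_fderiv, this.mfderiv]
    rfl
  rw [hc, hc, φ.mfderiv_extChartAt_symm_coordEndo x hy z, h]
  exact (ψ.coordEndo_mfderiv hfy _).symm

lemma nijenhuis_ιMulti (φ : AltTensor E M 1) (x : M) (v : Fin 2 → TangentSpace 𝓘(ℝ, E) x) :
    φ.nijenhuis.toFun x (exteriorPower.ιMulti ℝ 2 v) = φ.torsionBilin x (v 0) (v 1) :=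
  exteriorPower.alternatingMapLinearEquiv_apply_ιMulti (φ.torsionAlt x) v

end AltTensor

/-! ### Multiplicativity of a `(1,1)`-tensor on tangent vectors -/

namespace LieGroupoid

variable {E : Type*} [NormedAddCommGroup E] [NormedSpace ℝ E]
  {M : Type*} [TopologicalSpace M] [ChartedSpace E M] [IsManifold 𝓘(ℝ, E) ∞ M]
  {F : Type*} [NormedAddCommGroup F] [NormedSpace ℝ F]
  {Γ : Type*} [TopologicalSpace Γ] [ChartedSpace F Γ] [IsManifold 𝓘(ℝ, F) ∞ Γ]
  {G : LieGroupoid E M F Γ} {φΓ : AltTensor F Γ 1} {φM : AltTensor E M 1}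

/-- The base points agree by `hgh`, and every tangent space of `M` is the model `E`, so the
condition can be compared in `E` without transport. -/
lemma mem_tangentComposable_iff {g h : Γ} (hgh : G.tgt g = G.src h)
    (u : TangentSpace 𝓘(ℝ, F) g × TangentSpace 𝓘(ℝ, F) h) :
    u ∈ G.tangentComposable g h hgh ↔
      (mfderiv 𝓘(ℝ, F) 𝓘(ℝ, E) G.tgt g u.1 : E) = mfderiv 𝓘(ℝ, F) 𝓘(ℝ, E) G.src h u.2 := by
  have key : ∀ {x y : M} (_ : x = y) (a b : E),
      ((⟨x, a⟩ : TangentBundle 𝓘(ℝ, E) M) = ⟨y, b⟩) ↔ a = b := by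
    rintro x _ rfl a b
    exact Bundle.TotalSpace.mk_inj
  exact key hgh _ _

namespace IsMultiplicative

lemma mfderiv_src_endo (hφ : G.IsMultiplicative φΓ φM) (g : Γ) (v : TangentSpace 𝓘(ℝ, F) g) :
    mfderiv 𝓘(ℝ, F) 𝓘(ℝ, E) G.src g (φΓ.endo g v) =
      φM.endo (G.src g) (mfderiv 𝓘(ℝ, F) 𝓘(ℝ, E) G.src g v) := by
  have := hφ.map_src g (exteriorPower.ιMulti ℝ 1 fun _ => v)
  rw [exteriorPower.map_apply_ιMulti] at this
  rw [AltTensor.endo_apply, AltTensor.endo_apply]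
  exact this

lemma mfderiv_tgt_endo (hφ : G.IsMultiplicative φΓ φM) (g : Γ) (v : TangentSpace 𝓘(ℝ, F) g) :
    mfderiv 𝓘(ℝ, F) 𝓘(ℝ, E) G.tgt g (φΓ.endo g v) =
      φM.endo (G.tgt g) (mfderiv 𝓘(ℝ, F) 𝓘(ℝ, E) G.tgt g v) := by
  have := hφ.map_tgt g (exteriorPower.ιMulti ℝ 1 fun _ => v)
  rw [exteriorPower.map_apply_ιMulti] at this
  rw [AltTensor.endo_apply, AltTensor.endo_apply]
  exact this

lemma mfderiv_unit_endo (hφ : G.IsMultiplicative φΓ φM) (x : M) (v : TangentSpace 𝓘(ℝ, E) x) :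
    mfderiv 𝓘(ℝ, E) 𝓘(ℝ, F) G.unit x (φM.endo x v) =
      φΓ.endo (G.unit x) (mfderiv 𝓘(ℝ, E) 𝓘(ℝ, F) G.unit x v) := by
  have := hφ.map_unit x (exteriorPower.ιMulti ℝ 1 fun _ => v)
  rw [exteriorPower.map_apply_ιMulti] at this
  rw [AltTensor.endo_apply, AltTensor.endo_apply]
  exact this.symm

lemma mfderiv_inv_endo (hφ : G.IsMultiplicative φΓ φM) (g : Γ) (v : TangentSpace 𝓘(ℝ, F) g) :
    mfderiv 𝓘(ℝ, F) 𝓘(ℝ, F) G.inv g (φΓ.endo g v) =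
      φΓ.endo (G.inv g) (mfderiv 𝓘(ℝ, F) 𝓘(ℝ, F) G.inv g v) := by
  have := hφ.map_inv g (exteriorPower.ιMulti ℝ 1 fun _ => v)
  rw [exteriorPower.map_apply_ιMulti] at this
  rw [AltTensor.endo_apply, AltTensor.endo_apply]
  exact this.symm

lemma tangentMul_endo (hφ : G.IsMultiplicative φΓ φM) {g h : Γ} (hgh : G.tgt g = G.src h)
    (u : G.tangentComposable g h hgh) :
    ∃ hc : (φΓ.endo g u.1.1, φΓ.endo h u.1.2) ∈ G.tangentComposable g h hgh,
      G.tangentMul g h hgh ⟨_, hc⟩ = φΓ.endo (G.mul g h) (G.tangentMul g h hgh u) := by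
  obtain ⟨hc, hm⟩ := hφ.map_mul g h hgh (exteriorPower.ιMulti ℝ 1 fun _ => u)
  simp only [exteriorPower.map_apply_ιMulti] at hc hm
  simp only [AltTensor.endo_apply]
  exact ⟨hc, hm.symm⟩

end IsMultiplicative

end LieGroupoid

/-! ### Parametrized fibre products -/

section VectorSpace

variable {X : Type*} [NormedAddCommGroup X] [NormedSpace ℝ X] [FiniteDimensional ℝ X]
  {X' : Type*} [NormedAddCommGroup X'] [NormedSpace ℝ X'] [FiniteDimensional ℝ X']
  {Y : Type*} [NormedAddCommGroup Y] [NormedSpace ℝ Y] [FiniteDimensional ℝ Y]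

-- The operator is the sum of the contributions of the two factors, each a composite of
-- differentiable families.
omit [FiniteDimensional ℝ X] [FiniteDimensional ℝ X'] [FiniteDimensional ℝ Y] in
lemma differentiableAt_comp_prodMap_comp {P : X × X' →L[ℝ] Y} {B : Y → X →L[ℝ] X}
    {B' : Y → X' →L[ℝ] X'} {d : Y → Y →L[ℝ] X × X'} {y : Y} (hB : DifferentiableAt ℝ B y)
    (hB' : DifferentiableAt ℝ B' y) (hd : DifferentiableAt ℝ d y) :
    DifferentiableAt ℝ (fun w => P.comp ((((B w).comp (.fst ℝ X X')).prod
      ((B' w).comp (.snd ℝ X X'))).comp (d w))) y := by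
  have h1 : DifferentiableAt ℝ (fun w => (P.comp (.inl ℝ X X')).comp
      ((B w).comp ((ContinuousLinearMap.fst ℝ X X').comp (d w)))) y :=
    (differentiableAt_const _).clm_comp (hB.clm_comp ((differentiableAt_const _).clm_comp hd))
  have h2 : DifferentiableAt ℝ (fun w => (P.comp (.inr ℝ X X')).comp
      ((B' w).comp ((ContinuousLinearMap.snd ℝ X X').comp (d w)))) y :=
    (differentiableAt_const _).clm_comp (hB'.clm_comp ((differentiableAt_const _).clm_comp hd))
  refine (h1.add h2).congr_of_eventuallyEq (.of_forall fun w => ?_)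
  ext1 u
  simp [← map_add]

/-- A transverse fibre product has a smooth parametrization, and a pair of `(1,1)`-tensors whose
product preserves the tangent spaces of the fibre product restricts to it. -/
theorem exists_parametrization_fiberProduct {f : X → Y} {f' : X' → Y} {a : X} {a' : X'}
    (hf : ContDiffAt ℝ ∞ f a) (hf' : ContDiffAt ℝ ∞ f' a') (haa' : f a = f' a')
    (hs : Function.Surjective (fderiv ℝ f a))
    {B : X → X →L[ℝ] X} {B' : X' → X' →L[ℝ] X'}
    (hB : DifferentiableAt ℝ B a) (hB' : DifferentiableAt ℝ B' a')
    (h : ∀ᶠ x in 𝓝 (a, a'), f x.1 = f' x.2 → ∀ z z',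
      fderiv ℝ f x.1 z = fderiv ℝ f' x.2 z' →
        fderiv ℝ f x.1 (B x.1 z) = fderiv ℝ f' x.2 (B' x.2 z')) :
    ∃ (W : Submodule ℝ (X × X')) (A : W → W →L[ℝ] W) (p : W → X × X'),
      p 0 = (a, a') ∧ ContDiffAt ℝ ∞ p 0 ∧ DifferentiableAt ℝ A 0 ∧
      (∀ᶠ w in 𝓝 0, f (p w).1 = f' (p w).2) ∧
      (∀ᶠ w in 𝓝 0, ∀ u, fderiv ℝ p w (A w u) =
        (B (p w).1 (fderiv ℝ p w u).1, B' (p w).2 (fderiv ℝ p w u).2)) ∧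
      ∀ z z', fderiv ℝ f a z = fderiv ℝ f' a' z' → ∃ u, fderiv ℝ p 0 u = (z, z') := by
  -- The fibre product is the zero set of this difference, whose derivative is onto because that of
  -- `f` is.
  let k : X × X' → Y := fun x => f x.1 - f' x.2
  have hk : ContDiffAt ℝ ∞ k (a, a') :=
    (ContDiffAt.comp (a, a') hf contDiffAt_fst).sub (ContDiffAt.comp (a, a') hf' contDiffAt_snd)
  have hdk : ∀ᶠ x in 𝓝 (a, a'), ∀ z, fderiv ℝ k x z = fderiv ℝ f x.1 z.1 - fderiv ℝ f' x.2 z.2 := by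
    have h1 : ∀ᶠ y in 𝓝 a, DifferentiableAt ℝ f y :=
      ((hf.of_le (m := 1) (by simp)).eventually (by simp)).mono fun y hy =>
        hy.differentiableAt (by simp)
    have h2 : ∀ᶠ y in 𝓝 a', DifferentiableAt ℝ f' y :=
      ((hf'.of_le (m := 1) (by simp)).eventually (by simp)).mono fun y hy =>
        hy.differentiableAt (by simp)
    filter_upwards [(continuous_fst.tendsto (a, a')).eventually h1,
      (continuous_snd.tendsto (a, a')).eventually h2] with x hx1 hx2 z
    have := (hx1.hasFDerivAt.comp x hasFDerivAt_fst).sub (hx2.hasFDerivAt.comp x hasFDerivAt_snd)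
    have h3 : fderiv ℝ k x = _ := this.fderiv
    rw [h3]
    rfl
  have hks : Function.Surjective (fderiv ℝ k (a, a')) := fun y => by
    obtain ⟨z, hz⟩ := hs y
    exact ⟨(z, 0), by simp [hdk.self_of_nhds, hz]⟩
  obtain ⟨W, P, p, hp0, hp, hkp, hP⟩ :=
    exists_parametrization_of_surjective hk (by simp [k, haa']) hks
  have hpt : Filter.Tendsto p (𝓝 0) (𝓝 (a, a')) := hp0 ▸ hp.continuousAt.tendsto
  have hpd : ∀ᶠ w in 𝓝 0, DifferentiableAt ℝ p w :=
    ((hp.of_le (m := 1) (by simp)).eventually (by simp)).mono fun y hy =>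
      hy.differentiableAt (by simp)
  have hkd : ∀ᶠ x in 𝓝 (a, a'), DifferentiableAt ℝ k x :=
    ((hk.of_le (m := 1) (by simp)).eventually (by simp)).mono fun y hy =>
      hy.differentiableAt (by simp)
  -- The pullback of `B × B'` along `p`: `P` inverts `Dp` on vectors tangent to the fibre product.
  let A : W → W →L[ℝ] W := fun w =>
    P.comp ((((B (p w).1).comp (.fst ℝ X X')).prod ((B' (p w).2).comp (.snd ℝ X X'))).comp
      (fderiv ℝ p w))
  refine ⟨W, A, p, hp0, hp, ?_, ?_, ?_, ?_⟩
  · have h1 : DifferentiableAt ℝ p 0 := hp.differentiableAt (by simp)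
    have h2 : DifferentiableAt ℝ (fderiv ℝ p) 0 :=
      (hp.fderiv_right (m := 1) (by norm_cast)).differentiableAt (by simp)
    have h3 : DifferentiableAt ℝ (fun w => B (p w).1) 0 :=
      DifferentiableAt.comp (g := B) 0 (by rwa [hp0]) h1.fst
    have h4 : DifferentiableAt ℝ (fun w => B' (p w).2) 0 :=
      DifferentiableAt.comp (g := B') 0 (by rwa [hp0]) h1.snd
    exact differentiableAt_comp_prodMap_comp h3 h4 h2
  · exact hkp.mono fun w hw => sub_eq_zero.1 hw
  · filter_upwards [hkp.eventually_nhds, hP, hpd, hpt.eventually hkd, hpt.eventually hdk,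
      hpt.eventually h] with w hkw hPw hpw hkdw hdkw hw u
    have h1 : fderiv ℝ k (p w) (fderiv ℝ p w u) = 0 := by
      have h2 := hkdw.hasFDerivAt.comp w hpw.hasFDerivAt
      have h3 := h2.unique ((hasFDerivAt_const (0 : Y) w).congr_of_eventuallyEq hkw)
      exact DFunLike.congr_fun h3 u
    rw [hdkw, sub_eq_zero] at h1
    -- It remains to see that `B × B'` maps the vector `Dp u` into the kernel of `Dk`; `Dp u` lies
    -- there since `k ∘ p` vanishes near `w`, and `h` says that the kernel is preserved.
    refine hPw _ ?_
    rw [hdkw, sub_eq_zero]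
    exact hw (sub_eq_zero.1 hkw.self_of_nhds) _ _ h1
  · intro z z' hz
    refine ⟨P (z, z'), hP.self_of_nhds _ ?_⟩
    rw [hp0, hdk.self_of_nhds]
    exact sub_eq_zero.2 hz

end VectorSpace

/-! ### Maps into a manifold given in a chart -/

namespace AltTensor

variable {X : Type*} [NormedAddCommGroup X] [NormedSpace ℝ X]
  {E : Type*} [NormedAddCommGroup E] [NormedSpace ℝ E]
  {M : Type*} [TopologicalSpace M] [ChartedSpace E M] [IsManifold 𝓘(ℝ, E) ∞ M]

lemma eventually_mdifferentiableAt {f : X → M} {x : X}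
    (hf : ContMDiffAt 𝓘(ℝ, X) 𝓘(ℝ, E) ∞ f x) :
    ∀ᶠ y in 𝓝 x, MDifferentiableAt 𝓘(ℝ, X) 𝓘(ℝ, E) f y := by
  have : IsManifold 𝓘(ℝ, E) 1 M := IsManifold.of_le (n := ∞) (by norm_cast)
  exact (contMDiffAt_iff_contMDiffAt_nhds (by simp)).1
    (hf.of_le (n := ∞) (m := 1) (by norm_cast)) |>.mono fun y hy => hy.mdifferentiableAt (by simp)

lemma contMDiffAt_extChartAt_symm_comp {x₀ : M} {q : X → E} {x : X} (hq : ContDiffAt ℝ ∞ q x)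
    (hqx : q x = extChartAt 𝓘(ℝ, E) x₀ x₀) :
    ContMDiffAt 𝓘(ℝ, X) 𝓘(ℝ, E) ∞ (fun w => (extChartAt 𝓘(ℝ, E) x₀).symm (q w)) x :=
  ContMDiffAt.comp x (g := (extChartAt 𝓘(ℝ, E) x₀).symm)
    (contMDiffAt_extChartAt_symm x₀ (by rw [hqx]; exact mem_extChartAt_target x₀)) hq.contMDiffAt

lemma hasMFDerivAt_extChartAt_symm_comp {x₀ : M} {q : X → E} {x : X} {D : X →L[ℝ] E}
    (hq : HasFDerivAt q D x) (hqx : q x = extChartAt 𝓘(ℝ, E) x₀ x₀) :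
    HasMFDerivAt 𝓘(ℝ, X) 𝓘(ℝ, E) (fun w => (extChartAt 𝓘(ℝ, E) x₀).symm (q w)) x D := by
  have h := hasMFDerivAt_extChartAt_symm (E := E) x₀
  rw [← hqx] at h
  exact h.comp x hq.hasMFDerivAt

/-- Turns an intertwining relation in coordinates into one on the manifold. The free vector `z'`
will be `A w z`, for either component of the parametrization of `Γ⁽²⁾`. -/
lemma eventually_mfderiv_extChartAt_symm_comp [FiniteDimensional ℝ E] (φ : AltTensor E M 1)
    {x₀ : M} {q : X → E} {x : X} (hq : ContDiffAt ℝ ∞ q x)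
    (hqx : q x = extChartAt 𝓘(ℝ, E) x₀ x₀) :
    ∀ᶠ w in 𝓝 x, ∀ z z' : X,
      fderiv ℝ q w z' = φ.coordEndo x₀ ((extChartAt 𝓘(ℝ, E) x₀).symm (q w)) (fderiv ℝ q w z) →
      mfderiv 𝓘(ℝ, X) 𝓘(ℝ, E) (fun w => (extChartAt 𝓘(ℝ, E) x₀).symm (q w)) w z' =
        φ.endo ((extChartAt 𝓘(ℝ, E) x₀).symm (q w))
          (mfderiv 𝓘(ℝ, X) 𝓘(ℝ, E) (fun w => (extChartAt 𝓘(ℝ, E) x₀).symm (q w)) w z) := by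
  have hqd : ∀ᶠ w in 𝓝 x, DifferentiableAt ℝ q w :=
    ((hq.of_le (m := 1) (by simp)).eventually (by simp)).mono fun y hy =>
      hy.differentiableAt (by simp)
  have ht : ∀ᶠ w in 𝓝 x, q w ∈ (extChartAt 𝓘(ℝ, E) x₀).target :=
    hq.continuousAt.eventually (by rw [hqx]; exact extChartAt_target_mem_nhds x₀)
  filter_upwards [hqd, ht] with w hw htw z z' hz
  have h1 := (contMDiffAt_extChartAt_symm x₀ htw).mdifferentiableAt (by simp)
  have h2 := h1.hasMFDerivAt.comp w hw.hasFDerivAt.hasMFDerivAt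
  have h3 : ∀ a : X, mfderiv 𝓘(ℝ, X) 𝓘(ℝ, E) (fun w => (extChartAt 𝓘(ℝ, E) x₀).symm (q w)) w a =
      mfderiv 𝓘(ℝ, E) 𝓘(ℝ, E) (extChartAt 𝓘(ℝ, E) x₀).symm (q w) (fderiv ℝ q w a) :=
    fun a => DFunLike.congr_fun h2.mfderiv a
  rw [h3, h3, hz]
  exact φ.mfderiv_extChartAt_symm_coordEndo x₀ htw _

end AltTensor

/-! ### The torsion and the groupoid product -/

namespace LieGroupoid

variable {E : Type*} [NormedAddCommGroup E] [NormedSpace ℝ E]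
  {M : Type*} [TopologicalSpace M] [ChartedSpace E M] [IsManifold 𝓘(ℝ, E) ∞ M]
  {F : Type*} [NormedAddCommGroup F] [NormedSpace ℝ F]
  {Γ : Type*} [TopologicalSpace Γ] [ChartedSpace F Γ] [IsManifold 𝓘(ℝ, F) ∞ Γ]
  {X : Type*} [NormedAddCommGroup X] [NormedSpace ℝ X]
  {G : LieGroupoid E M F Γ} {φΓ : AltTensor F Γ 1} {φM : AltTensor E M 1}

lemma mfderiv_mem_tangentComposable {f f' : X → Γ} {x : X}
    (hf : MDifferentiableAt 𝓘(ℝ, X) 𝓘(ℝ, F) f x) (hf' : MDifferentiableAt 𝓘(ℝ, X) 𝓘(ℝ, F) f' x)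
    (h : ∀ᶠ y in 𝓝 x, G.tgt (f y) = G.src (f' y)) (z : X) :
    (mfderiv 𝓘(ℝ, X) 𝓘(ℝ, F) f x z, mfderiv 𝓘(ℝ, X) 𝓘(ℝ, F) f' x z) ∈
      G.tangentComposable (f x) (f' x) h.self_of_nhds := by
  rw [mem_tangentComposable_iff]
  have h1 := (G.smooth_tgt.mdifferentiable (by simp) (f x)).hasMFDerivAt.comp x hf.hasMFDerivAt
  have h2 := (G.smooth_src.mdifferentiable (by simp) (f' x)).hasMFDerivAt.comp x hf'.hasMFDerivAt
  have e : G.tgt ∘ f =ᶠ[𝓝 x] G.src ∘ f' := h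
  have h3 := e.mfderiv_eq (I := 𝓘(ℝ, X)) (I' := 𝓘(ℝ, E))
  rw [h1.mfderiv, h2.mfderiv] at h3
  exact DFunLike.congr_fun h3 z

/-- The product of two smooth maps with values in composable pairs is differentiable. -/
lemma hasMFDerivAt_mul {f f' : X → Γ} {x : X}
    {D D' : X →L[ℝ] F}
    (hf : HasMFDerivAt 𝓘(ℝ, X) 𝓘(ℝ, F) f x D) (hf' : HasMFDerivAt 𝓘(ℝ, X) 𝓘(ℝ, F) f' x D')
    (h : ∀ᶠ y in 𝓝 x, G.tgt (f y) = G.src (f' y)) {g g' : Γ} (hg : f x = g) (hg' : f' x = g') :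
    HasMFDerivAt 𝓘(ℝ, X) 𝓘(ℝ, F) (fun y => G.mul (f y) (f' y)) x
      (ContinuousLinearMap.comp (mfderivWithin ((𝓘(ℝ, F)).prod 𝓘(ℝ, F)) 𝓘(ℝ, F)
        (fun p : Γ × Γ => G.mul p.1 p.2) G.composable (g, g') : F × F →L[ℝ] F)
        (D.prod D')) := by
  subst hg hg'
  have hm : MDifferentiableWithinAt ((𝓘(ℝ, F)).prod 𝓘(ℝ, F)) 𝓘(ℝ, F)
      (fun p : Γ × Γ => G.mul p.1 p.2) G.composable (f x, f' x) :=
    G.smooth_mul.mdifferentiableOn (by simp) _ h.self_of_nhds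
  have h1 := hf.prodMk hf'
  -- The product is differentiable only within `Γ⁽²⁾`, but `(f, f')` takes values there on a
  -- neighbourhood of `x`, so the composite has a full derivative.
  have h2 := hm.hasMFDerivWithinAt.comp x (f := fun y => (f y, f' y))
    (s := {y | G.tgt (f y) = G.src (f' y)}) h1.hasMFDerivWithinAt (fun y hy => hy)
  exact h2.hasMFDerivAt h

lemma contMDiffAt_mul {f f' : X → Γ} {x : X}
    (hf : ContMDiffAt 𝓘(ℝ, X) 𝓘(ℝ, F) ∞ f x) (hf' : ContMDiffAt 𝓘(ℝ, X) 𝓘(ℝ, F) ∞ f' x)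
    (h : ∀ᶠ y in 𝓝 x, G.tgt (f y) = G.src (f' y)) :
    ContMDiffAt 𝓘(ℝ, X) 𝓘(ℝ, F) ∞ (fun y => G.mul (f y) (f' y)) x := by
  have h1 := (hf.prodMk hf').contMDiffWithinAt (s := {y | G.tgt (f y) = G.src (f' y)})
  have h2 := (G.smooth_mul (f x, f' x) h.self_of_nhds).comp x h1 (fun y hy => hy)
  exact h2.contMDiffAt h

variable [FiniteDimensional ℝ E] [FiniteDimensional ℝ F]

namespace IsMultiplicative

/-- Composability follows from naturality for source and target; the formula comes from comparing
three images of one torsion on a parametrization of `Γ⁽²⁾`. -/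
lemma torsionBilin_mul (hφ : G.IsMultiplicative φΓ φM) {g h : Γ} (hgh : G.tgt g = G.src h)
    (u v : G.tangentComposable g h hgh) :
    ∃ hc : (φΓ.torsionBilin g u.1.1 v.1.1, φΓ.torsionBilin h u.1.2 v.1.2) ∈
        G.tangentComposable g h hgh,
      φΓ.torsionBilin (G.mul g h) (G.tangentMul g h hgh u) (G.tangentMul g h hgh v) =
        G.tangentMul g h hgh ⟨_, hc⟩ := by
  have hc : (φΓ.torsionBilin g u.1.1 v.1.1, φΓ.torsionBilin h u.1.2 v.1.2) ∈
        G.tangentComposable g h hgh := by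
    rw [mem_tangentComposable_iff]
    have h1 := φΓ.mfderiv_torsionBilin φM G.smooth_tgt hφ.mfderiv_tgt_endo g u.1.1 v.1.1
    have h2 := φΓ.mfderiv_torsionBilin φM G.smooth_src hφ.mfderiv_src_endo h u.1.2 v.1.2
    have hu := (mem_tangentComposable_iff hgh u.1).1 u.2
    have hv := (mem_tangentComposable_iff hgh v.1).1 v.2
    have key : ∀ {x y : M} (_ : x = y) {a b c d : E} (_ : a = c) (_ : b = d),
        (φM.torsionBilin x a b : E) = φM.torsionBilin y c d := by
      rintro _ _ rfl _ _ _ _ rfl rfl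
      rfl
    exact h1.trans ((key hgh hu hv).trans h2.symm)
  refine ⟨hc, ?_⟩
  set c := extChartAt 𝓘(ℝ, F) g with hcg
  set c' := extChartAt 𝓘(ℝ, F) h with hch
  set cM := extChartAt 𝓘(ℝ, E) (G.tgt g) with hcM
  have hτ : ContDiffAt ℝ ∞ (cM ∘ G.tgt ∘ c.symm) (c g) :=
    AltTensor.contDiffAt_extChartAt_comp rfl G.smooth_tgt
  have hσ : ContDiffAt ℝ ∞ (cM ∘ G.src ∘ c'.symm) (c' h) :=
    AltTensor.contDiffAt_extChartAt_comp hgh.symm G.smooth_src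
  have hτ' := AltTensor.hasFDerivAt_extChartAt_comp (q := G.tgt g) rfl
    (G.smooth_tgt.mdifferentiable (by simp) g).hasMFDerivAt
  have hσ' := AltTensor.hasFDerivAt_extChartAt_comp (q := G.tgt g) hgh.symm
    (G.smooth_src.mdifferentiable (by simp) h).hasMFDerivAt
  have ec : c.symm (c g) = g := extChartAt_to_inv g
  have ec' : c'.symm (c' h) = h := extChartAt_to_inv h
  have hfst : Filter.Tendsto Prod.fst (𝓝 (c g, c' h)) (𝓝 (c g)) := continuous_fst.tendsto _
  have hsnd : Filter.Tendsto Prod.snd (𝓝 (c g, c' h)) (𝓝 (c' h)) := continuous_snd.tendsto _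
  have htS := AltTensor.eventually_mem_chartAt_source (E := F) (E' := E) (x := g)
    (q := G.tgt g) rfl G.smooth_tgt.continuous
  have hsS := AltTensor.eventually_mem_chartAt_source (E := F) (E' := E) (x := h)
    (q := G.tgt g) hgh.symm G.smooth_src.continuous
  obtain ⟨W, A, p, hp0, hp, hA, hpW, hpA, hps⟩ := exists_parametrization_fiberProduct
    (B := fun y => φΓ.coordEndo g (c.symm y)) (B' := fun y => φΓ.coordEndo h (c'.symm y)) hτ hσ
    (by simp [ec, ec', hgh]) (by rw [hτ'.fderiv]; exact G.submersion_tgt g)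
    ((φΓ.coordEndo_contDiffAt g).differentiableAt (by simp))
    ((φΓ.coordEndo_contDiffAt h).differentiableAt (by simp)) (by
      filter_upwards [hfst.eventually (φΓ.eventually_fderiv_coordEndo φM G.smooth_tgt
          hφ.mfderiv_tgt_endo rfl), hsnd.eventually (φΓ.eventually_fderiv_coordEndo φM G.smooth_src
          hφ.mfderiv_src_endo hgh.symm), hfst.eventually htS, hsnd.eventually hsS]
        with x h1 h2 h3 h4 heq z z' hz
      -- A chart is injective on its source, so equal coordinates mean a composable pair, and both
      -- sides involve `φM` at the same point.
      have e : G.tgt (c.symm x.1) = G.src (c'.symm x.2) :=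
        cM.injOn (by rwa [hcM, extChartAt_source]) (by rwa [hcM, extChartAt_source]) heq
      refine (h1 z).trans (Eq.trans ?_ (h2 z').symm)
      rw [e]
      exact congrArg _ hz)
  have hp1 : ContDiffAt ℝ ∞ (fun w => (p w).1) 0 := hp.fst
  have hp2 : ContDiffAt ℝ ∞ (fun w => (p w).2) 0 := hp.snd
  have hpd := hp.differentiableAt (by simp)
  have hp10 : (p 0).1 = c g := by rw [hp0]
  have hp20 : (p 0).2 = c' h := by rw [hp0]
  set f : W → Γ := fun w => c.symm (p w).1 with hf
  set f' : W → Γ := fun w => c'.symm (p w).2 with hf'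
  have hf0 : f 0 = g := by simp [hf, hp0, ec]
  have hf'0 : f' 0 = h := by simp [hf', hp0, ec']
  have hfs : ContMDiffAt 𝓘(ℝ, W) 𝓘(ℝ, F) ∞ f 0 :=
    AltTensor.contMDiffAt_extChartAt_symm_comp hp1 hp10
  have hf's : ContMDiffAt 𝓘(ℝ, W) 𝓘(ℝ, F) ∞ f' 0 :=
    AltTensor.contMDiffAt_extChartAt_symm_comp hp2 hp20
  have hfd : HasMFDerivAt 𝓘(ℝ, W) 𝓘(ℝ, F) f 0
      ((ContinuousLinearMap.fst ℝ F F).comp (fderiv ℝ p 0)) :=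
    AltTensor.hasMFDerivAt_extChartAt_symm_comp hpd.hasFDerivAt.fst hp10
  have hf'd : HasMFDerivAt 𝓘(ℝ, W) 𝓘(ℝ, F) f' 0
      ((ContinuousLinearMap.snd ℝ F F).comp (fderiv ℝ p 0)) :=
    AltTensor.hasMFDerivAt_extChartAt_symm_comp hpd.hasFDerivAt.snd hp20
  have hpd' : ∀ᶠ w in 𝓝 0, DifferentiableAt ℝ p w :=
    ((hp.of_le (m := 1) (by simp)).eventually (by simp)).mono fun y hy =>
      hy.differentiableAt (by simp)
  have hfA : ∀ᶠ w in 𝓝 0, ∀ z : W, mfderiv 𝓘(ℝ, W) 𝓘(ℝ, F) f w (A w z) =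
      φΓ.endo (f w) (mfderiv 𝓘(ℝ, W) 𝓘(ℝ, F) f w z) := by
    filter_upwards [φΓ.eventually_mfderiv_extChartAt_symm_comp hp1 hp10, hpA, hpd']
      with w hw hAw hdw z
    refine hw z (A w z) ?_
    rw [hdw.hasFDerivAt.fst.fderiv]
    exact congrArg Prod.fst (hAw z)
  have hf'A : ∀ᶠ w in 𝓝 0, ∀ z : W, mfderiv 𝓘(ℝ, W) 𝓘(ℝ, F) f' w (A w z) =
      φΓ.endo (f' w) (mfderiv 𝓘(ℝ, W) 𝓘(ℝ, F) f' w z) := by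
    filter_upwards [φΓ.eventually_mfderiv_extChartAt_symm_comp hp2 hp20, hpA, hpd']
      with w hw hAw hdw z
    refine hw z (A w z) ?_
    rw [hdw.hasFDerivAt.snd.fderiv]
    exact congrArg Prod.snd (hAw z)
  have hff' : ∀ᶠ w in 𝓝 0, G.tgt (f w) = G.src (f' w) := by
    have t1 : Filter.Tendsto (fun w => (p w).1) (𝓝 0) (𝓝 (c g)) := hp10 ▸ hp1.continuousAt.tendsto
    have t2 : Filter.Tendsto (fun w => (p w).2) (𝓝 0) (𝓝 (c' h)) := hp20 ▸ hp2.continuousAt.tendsto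
    filter_upwards [hpW, t1.eventually htS, t2.eventually hsS] with w hw h1 h2
    exact cM.injOn (by rwa [hcM, extChartAt_source]) (by rwa [hcM, extChartAt_source]) hw
  have hmd := AltTensor.eventually_mdifferentiableAt hfs
  have hm'd := AltTensor.eventually_mdifferentiableAt hf's
  have hD := hasMFDerivAt_mul hfd hf'd hff' hf0 hf'0
  -- The product of the two components intertwines `A` with `φΓ`, because both components do and
  -- `φΓ` is multiplicative.
  have hmul := φΓ.hasMFDerivAt_localTorsion (f := fun w => G.mul (f w) (f' w)) hA
    (contMDiffAt_mul hfs hf's hff') (by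
      filter_upwards [hff'.eventually_nhds, hmd, hm'd, hfA, hf'A] with w hw hfw hf'w hAw hA'w z
      have h1 := hasMFDerivAt_mul (D := mfderiv 𝓘(ℝ, W) 𝓘(ℝ, F) f w)
        (D' := mfderiv 𝓘(ℝ, W) 𝓘(ℝ, F) f' w) hfw.hasMFDerivAt hf'w.hasMFDerivAt hw rfl rfl
      rw [h1.mfderiv]
      obtain ⟨hc, h2⟩ := hφ.tangentMul_endo hw.self_of_nhds
        ⟨_, mfderiv_mem_tangentComposable hfw hf'w hw z⟩
      refine Eq.trans ?_ h2
      exact congrArg (mfderivWithin ((𝓘(ℝ, F)).prod 𝓘(ℝ, F)) 𝓘(ℝ, F)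
        (fun p : Γ × Γ => G.mul p.1 p.2) G.composable (f w, f' w)) (Prod.ext (hAw z) (hA'w z))) hD
    (show G.mul (f 0) (f' 0) = G.mul g h by rw [hf0, hf'0])
  -- The derivative of `p` at `0` reaches every vector tangent to `Γ⁽²⁾`, so `u` and `v` lift to
  -- vectors `a` and `b` of `W`.
  obtain ⟨a, ha⟩ := hps u.1.1 u.1.2 (by
    rw [hτ'.fderiv, hσ'.fderiv]
    exact (mem_tangentComposable_iff hgh u.1).1 u.2)
  obtain ⟨b, hb⟩ := hps v.1.1 v.1.2 (by
    rw [hτ'.fderiv, hσ'.fderiv]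
    exact (mem_tangentComposable_iff hgh v.1).1 v.2)
  have k1 := (φΓ.hasMFDerivAt_localTorsion hA hfs hfA hfd hf0 a b).trans
    (congrArg₂ (fun s t : F => (φΓ.torsionBilin g s t : F)) (congrArg Prod.fst ha)
      (congrArg Prod.fst hb))
  have k2 := (φΓ.hasMFDerivAt_localTorsion hA hf's hf'A hf'd hf'0 a b).trans
    (congrArg₂ (fun s t : F => (φΓ.torsionBilin h s t : F)) (congrArg Prod.snd ha)
      (congrArg Prod.snd hb))
  let m : F × F →L[ℝ] F := mfderivWithin ((𝓘(ℝ, F)).prod 𝓘(ℝ, F)) 𝓘(ℝ, F)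
    (fun p : Γ × Γ => G.mul p.1 p.2) G.composable (g, h)
  have k3 : fderiv ℝ p 0 (localTorsion A 0 a b) =
      (φΓ.torsionBilin g u.1.1 v.1.1, φΓ.torsionBilin h u.1.2 v.1.2) := Prod.ext k1 k2
  -- `m` applied to the image of `localTorsion A 0 a b` under `Dp` is computed twice: through the
  -- components by `k3`, through the product by `hmul`.
  have k4 := (congrArg m k3).symm.trans ((hmul a b).trans
    (congrArg₂ (fun s t : F × F => (φΓ.torsionBilin (G.mul g h) (m s) (m t) : F)) ha hb))
  exact k4.symm

end IsMultiplicative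

end LieGroupoid

/-! ### Passage to bivectors and conclusion -/

/-- A linear map on an exterior power factors through a linear map on a submodule as soon as it does
so on decomposable elements. -/
lemma exteriorPower.exists_mem_of_ιMulti {R V V₁ V₂ V₃ : Type*} [CommRing R]
    [AddCommGroup V] [Module R V] [AddCommGroup V₁] [Module R V₁] [AddCommGroup V₂] [Module R V₂]
    [AddCommGroup V₃] [Module R V₃] {k : ℕ} {S : Submodule R (V₁ × V₂)}
    {L₁ : ⋀[R]^k V →ₗ[R] V₁} {L₂ : ⋀[R]^k V →ₗ[R] V₂} {L₃ : ⋀[R]^k V →ₗ[R] V₃} {T : S →ₗ[R] V₃}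
    (h : ∀ v : Fin k → V, ∃ hc : (L₁ (exteriorPower.ιMulti R k v),
      L₂ (exteriorPower.ιMulti R k v)) ∈ S, L₃ (exteriorPower.ιMulti R k v) = T ⟨_, hc⟩)
    (Ξ : ⋀[R]^k V) : ∃ hc : (L₁ Ξ, L₂ Ξ) ∈ S, L₃ Ξ = T ⟨_, hc⟩ := by
  have hS : ∀ Ξ, L₁.prod L₂ Ξ ∈ S := by
    have : Submodule.span R (Set.range (exteriorPower.ιMulti R k)) ≤ S.comap (L₁.prod L₂) := by
      rw [Submodule.span_le]
      rintro _ ⟨v, rfl⟩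
      exact (h v).1
    rw [exteriorPower.ιMulti_span] at this
    exact fun Ξ => this trivial
  -- With membership known everywhere, the claim is an equality of linear maps, which can be tested
  -- on decomposables.
  refine ⟨hS Ξ, LinearMap.congr_fun (f := L₃) (g := T ∘ₗ (L₁.prod L₂).codRestrict S hS) ?_ Ξ⟩
  ext v
  exact (h v).2

theorem mainTheorem8
    {E : Type*} [NormedAddCommGroup E] [NormedSpace ℝ E] [FiniteDimensional ℝ E]
    {M : Type*} [TopologicalSpace M] [ChartedSpace E M] [IsManifold 𝓘(ℝ, E) ∞ M]
    {F : Type*} [NormedAddCommGroup F] [NormedSpace ℝ F] [FiniteDimensional ℝ F]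
    {Γ : Type*} [TopologicalSpace Γ] [ChartedSpace F Γ] [IsManifold 𝓘(ℝ, F) ∞ Γ]
    (G : LieGroupoid E M F Γ) (φΓ : AltTensor F Γ 1) (φM : AltTensor E M 1)
    (hφ : G.IsMultiplicative φΓ φM) :
    G.IsMultiplicative φΓ.nijenhuis φM.nijenhuis := by
  refine ⟨fun g ξ => ?_, fun g ξ => ?_, fun x ξ => ?_, fun g ξ => ?_, fun g h hgh Ξ => ?_⟩
  -- Both sides are linear in `ξ`, so decomposable bivectors suffice, and there the claim is
  -- naturality. The next three clauses go the same way.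
  · refine LinearMap.congr_fun (f := G.tangentSrc g ∘ₗ φΓ.nijenhuis.toFun g)
      (g := φM.nijenhuis.toFun _ ∘ₗ exteriorPower.map 2 (G.tangentSrc g)) ?_ ξ
    ext v
    simp only [LinearMap.compAlternatingMap_apply, LinearMap.comp_apply,
      exteriorPower.map_apply_ιMulti, AltTensor.nijenhuis_ιMulti]
    exact φΓ.mfderiv_torsionBilin φM G.smooth_src hφ.mfderiv_src_endo g (v 0) (v 1)
  · refine LinearMap.congr_fun (f := G.tangentTgt g ∘ₗ φΓ.nijenhuis.toFun g)
      (g := φM.nijenhuis.toFun _ ∘ₗ exteriorPower.map 2 (G.tangentTgt g)) ?_ ξ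
    ext v
    simp only [LinearMap.compAlternatingMap_apply, LinearMap.comp_apply,
      exteriorPower.map_apply_ιMulti, AltTensor.nijenhuis_ιMulti]
    exact φΓ.mfderiv_torsionBilin φM G.smooth_tgt hφ.mfderiv_tgt_endo g (v 0) (v 1)
  · refine LinearMap.congr_fun (f := φΓ.nijenhuis.toFun _ ∘ₗ exteriorPower.map 2 (G.tangentUnit x))
      (g := G.tangentUnit x ∘ₗ φM.nijenhuis.toFun x) ?_ ξ
    ext v
    simp only [LinearMap.compAlternatingMap_apply, LinearMap.comp_apply,
      exteriorPower.map_apply_ιMulti, AltTensor.nijenhuis_ιMulti]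
    exact (φM.mfderiv_torsionBilin φΓ G.smooth_unit hφ.mfderiv_unit_endo x (v 0) (v 1)).symm
  · refine LinearMap.congr_fun (f := φΓ.nijenhuis.toFun _ ∘ₗ exteriorPower.map 2 (G.tangentInv g))
      (g := G.tangentInv g ∘ₗ φΓ.nijenhuis.toFun g) ?_ ξ
    ext v
    simp only [LinearMap.compAlternatingMap_apply, LinearMap.comp_apply,
      exteriorPower.map_apply_ιMulti, AltTensor.nijenhuis_ιMulti]
    exact (φΓ.mfderiv_torsionBilin φΓ G.smooth_inv hφ.mfderiv_inv_endo g (v 0) (v 1)).symm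
  · refine exteriorPower.exists_mem_of_ιMulti
      (L₁ := φΓ.nijenhuis.toFun g ∘ₗ exteriorPower.map 2 (G.tangentFst g h hgh))
      (L₂ := φΓ.nijenhuis.toFun h ∘ₗ exteriorPower.map 2 (G.tangentSnd g h hgh))
      (L₃ := φΓ.nijenhuis.toFun _ ∘ₗ exteriorPower.map 2 (G.tangentMul g h hgh))
      (T := G.tangentMul g h hgh) (fun v => ?_) Ξ
    obtain ⟨hc, hm⟩ := hφ.torsionBilin_mul hgh (v 0) (v 1)
    simp only [LinearMap.comp_apply, exteriorPower.map_apply_ιMulti, AltTensor.nijenhuis_ιMulti]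
    exact ⟨hc, hm⟩
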